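/- **Setting.** Let $\mathbb R^{1,2}$ be $\mathbb R^3$ with the metric $h=dx_1^2-dx_2^2-dx_3^2$ and let $g_0=u^2(dv^2-du^2)$ on $M=\{(u,v):u\neq 0\}$. On $\mathbb R^8$ with coordinates $(p,q,p_0,q_0,x_1,x_2,x_3,v)$ put $$u=-\tfrac12p_0q_0(p-q),\qquad \mathsf e_3=\Big(-\tfrac{p_0^2(p^2+1)-q_0^2(q^2+1)}{2p_0q_0(p-q)},\ -\tfrac{p_0^2(p^2-1)-q_0^2(q^2-1)}{2p_0q_0(p-q)},\ \tfrac{p_0^2p-q_0^2q}{p_0q_0(p-q)}\Big),$$ where $\mathsf e_3$ is the third vector of the orthonormal frame $\mathsf e_1=\big(-\tfrac{p_0^2(p^2+1)+q_0^2(q^2+1)}{2p_0q_0(p-q)},-\tfrac{p_0^2(p^2-1)+q_0^2(q^2-1)}{2p_0q_0(p-q)},\tfrac{p_0^2p+q_0^2q}{p_0q_0(p-q)}\big)$, $\mathsf e_2=\tfrac1{p-q}(pq+1,\,pq-1,\,-(p+q))$, $\mathsf e_3$. Let $\widetilde N_1=\{p\ne q,\ p_0\neq0,\ q_0\ne0\}$,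 and let $N_1\subset\widetilde N_1$ be the image of $\{u>0,\ a_1>0,\ a_1\pm a_2\ne0\}$ under $$\phi(u,v,a_j,x_i)=(p,q,p_0,q_0,x_i,v),\quad p=a_3-\tfrac1{a_1-a_2},\ q=a_3+\tfrac1{a_1+a_2},\ p_0=\tfrac{\sqrt u(a_1-a_2)}{\sqrt{a_1}},\ q_0=\tfrac{\sqrt u(a_1+a_2)}{\sqrt{a_1}} .$$ Let $\mathcal V^1_\pm$ be the Pfaffian systems $$\begin{aligned}\mathcal V^1_+=\{&dq,\ dq_0,\ dv+\tfrac12p_0^2dp,\\ &dx_1+\tfrac18p_0^2(p_0^2(p^2+1)+q_0^2(q^2-2pq-1))dp-\tfrac14p_0q_0^2(p-q)(pq+1)dp_0,\\ &dx_2+\tfrac18p_0^2(p_0^2(p^2-1)+q_0^2(q^2-2pq+1))dp-\tfrac14p_0q_0^2(p-q)(pq-1)dp_0,\\ &dx_3-\tfrac14pp_0^2(p_0^2-q_0^2)dp+\tfrac14p_0q_0^2(p^2-q^2)dp_0\},\\ \mathcal V^1_-=\{&dp,\ dp_0,\ dv-\tfrac12q_0^2dq,\\ &dx_1-\tfrac18q_0^2(p_0^2(p^2-2pq-1)+q_0^2(q^2+1))dq-\tfrac14p_0^2q_0(p-q)(pq+1)dq_0,\\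 &dx_2-\tfrac18q_0^2(p_0^2(p^2-2pq+1)+q_0^2(q^2-1))dq-\tfrac14p_0^2q_0(p-q)(pq-1)dq_0,\\ &dx_3-\tfrac14qq_0^2(p_0^2-q_0^2)dq+\tfrac14p_0^2q_0(p^2-q^2)dq_0\},\end{aligned}$$ and $\mathcal V^1=\mathcal V^1_+\cap\mathcal V^1_-$ (rank 4). An integral curve of $\mathcal V^1$ is *non-characteristic* if its velocity is never annihilated by all of $\mathcal V^1_+$ and never by all of $\mathcal V^1_-$. Let $\psi(p,q,p_0,q_0,x,v)=(p,q,p_0,q_0,y,v)$ with $$y_1=x_1-\tfrac18p_0^2q_0^2(p-q)(1+pq),\quad y_2=x_2+\tfrac18p_0^2q_0^2(p-q)(1-pq),\quad y_3=x_3+\tfrac18p_0^2q_0^2(p^2-q^2),$$ let $N_2=\psi(N_1)$, $\widetilde N_2=\psi(\widetilde N_1)$, and let $\mathcal I^2$ be generated by $dp\wedge dp_0$, $dq\wedge dq_0$ and $$\begin{aligned}&dv+\tfrac12p_0^2dp-\tfrac12q_0^2dq,\quad dy_1+\tfrac18p_0^4(p^2+1)dp-\tfrac18q_0^4(q^2+1)dq,\\&dy_2+\tfrac18p_0^4(p^2-1)dp-\tfrac18q_0^4(q^2-1)dq,\quad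 dy_3-\tfrac14pp_0^4dp+\tfrac14qq_0^4dq.\end{aligned}$$ A curve $\sigma_+=(p,p_0,v^+,y^+)$ in $\widehat M_1=\mathbb R^6$ (resp. $\sigma_-=(q,q_0,v^-,y^-)$ in $\widehat M_2=\mathbb R^6$) is called *characteristic* if it annihilates the $dp$-parts of these four 1-forms, $dv^++\tfrac12p_0^2dp$, $dy_1^++\tfrac18p_0^4(p^2+1)dp$, $dy_2^++\tfrac18p_0^4(p^2-1)dp$, $dy_3^+-\tfrac14pp_0^4dp$ (resp. the $dq$-parts), and the superposition is $\sigma_+*\sigma_-=(p,q,p_0,q_0,\,y^++y^-,\,v^++v^-)$. Let $\pi$ be the projection to $(x_1,x_2,x_3)$. **Theorem.** Let $\gamma=(\bar x_1,\bar x_2,\bar x_3):(a,b)\to\mathbb R^{1,2}$ be a smooth immersed curve with $\bar x_1'-\bar x_2'\ne0$ and $\bar x_3'\neq0$ on $(a,b)$, and let $t_0\in(a,b)$. There are an open interval $J=(\bar a,\bar b)\subset(a,b)$ containing $t_0$ and smooth functions $p,p_0,q,q_0,v$ on $J$ such that: 1. $p_0=q_0=r$, where $r,r'$ have no zeros on $J$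 and $r$ solves $$(\bar x_1'-\bar x_2')^4rr''-4(\bar x_1'^2-\bar x_2'^2-\bar x_3'^2)r^6r'^4+2(\bar x_1'-\bar x_2')^4r'^2-(\bar x_1'-\bar x_2')^3(\bar x_1''-\bar x_2'')rr'=0,$$ and $p=\frac{\bar x_3'}{\bar x_2'-\bar x_1'}+s$, $q=\frac{\bar x_3'}{\bar x_2'-\bar x_1'}-s$ with $s=\frac{\bar x_1'-\bar x_2'}{2r^3r'}$. The curve $\sigma_0=(p,q,p_0,q_0,\bar x_1,\bar x_2,\bar x_3,v):J\to N_1$ is a non-characteristic integral curve of $\mathcal V^1$; with the corresponding frame $(\mathsf e_1,\mathsf e_2,\mathsf e_3)$ and $u,v$ it is an integral curve of the 1-forms $\omega^3,\ \omega^1-u\,dv,\ \omega^2-u\,du,\ \omega^1_2-u^{-1}dv$ of the isometric embedding system (where $dx=\mathsf e_i\omega^i$, $d\mathsf e_j=\mathsf e_i\omega^i_j$). The vector $\mathsf e_3(t)$ lies in the lightlike plane $z_1=z_2$ of $T_{\gamma(t)}\mathbb R^{1,2}$ for all $t\in J$. 2. The curve $\sigma=\psi\circ\sigma_0$ has a decomposition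 $\sigma(t)=\sigma_+(t)*\sigma_-(t)$ on $J$ into characteristic curves $\sigma_\pm$. It is unique up to adding constants to $(v^+,y^+)$ and subtracting them from $(v^-,y^-)$. The map $\iota_2(t_1,t_2)=\sigma_+(t_1)*\sigma_-(t_2)$, $J\times J\to N_2$, does not depend on the decomposition and is an immersed 2-dimensional integral manifold of $\mathcal I^2$. 3. Suppose in addition that the derivative of $\bar x_3'/(\bar x_1'-\bar x_2')$ does not vanish at $t_0$. Then $(t_1,t_2)\mapsto(u,v)$ is a diffeomorphism of $J\times J$ onto an open subset $U$ of $M$, and $\pi\circ\psi^{-1}\circ\iota_2$, regarded as a map on $U$, is an isometric embedding of $(U,g_0)$ into $\mathbb R^{1,2}$ whose image contains $\gamma(J)$. 4. Suppose that on $(a,b)$ the curve $\gamma$ satisfies the relation $$-4(\bar x_1'^2-\bar x_2'^2-\bar x_3'^2)t^6+2(\bar x_1'-\bar x_2')^4-(\bar x_1'-\bar x_2')^3(\bar x_1''-\bar x_2'')t=0.$$ Then $J$ and the functions in 1–3 can be chosen with $r(t)=t$, and likewise with $r(t)=-t$, so that all components of $\sigma_0$, $\sigma_+$, $\sigma_-$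 are obtained by quadratures from $\gamma$: they are built from the constants, $t$, and the $\bar x_i,\bar x_i',\bar x_i''$ by finitely many additions, multiplications, reciprocals and antiderivatives. Here $N_1,N_2$ are replaced by $\widetilde N_1,\widetilde N_2$, since now $u=-(\bar x_1'-\bar x_2')/(2t)$ along $\gamma$, which may be negative; if it is positive at $t_0$, then $N_1,N_2$ can be kept for the choice of sign with $r(t_0)>0$. -/

import Mathlib

open scoped ContDiff

namespace CauchyEmbedding

/-! ### Minkowski space and the metric `u² (dv² - du²)` -/

/-- The underlying vector space of `ℝ^{1,2}`; the metric is `mink`. -/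
abbrev Mink : Type := Fin 3 → ℝ

/-- The inner product `x₁ y₁ - x₂ y₂ - x₃ y₃`. -/
def mink (x y : Mink) : ℝ := x 0 * y 0 - x 1 * y 1 - x 2 * y 2

/-- The metric `g₀ = u² (dv² - du²)`; points and tangent vectors are written `(u, v)`. -/
def gZero (m w z : ℝ × ℝ) : ℝ := m.1 ^ 2 * (w.2 * z.2 - w.1 * z.1)

/-- `ι` is an isometric embedding of the open subset `U` of `({u ≠ 0}, g₀)` into `ℝ^{1,2}`.
It is an immersion because `g₀` is nondegenerate where `u ≠ 0`. -/
structure IsIsometricEmbedding (U : Set (ℝ × ℝ)) (ι : ℝ × ℝ → Mink) : Prop where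
  isOpen : IsOpen U
  nondegenerate : ∀ m ∈ U, m.1 ≠ 0
  smooth : ContDiffOn ℝ ∞ ι U
  isometric : ∀ m ∈ U, ∀ w z : ℝ × ℝ, mink (fderiv ℝ ι m w) (fderiv ℝ ι m z) = gZero m w z
  embedding : Topology.IsEmbedding (U.domRestrict ι)

/-! ### The two eight-dimensional coordinate spaces -/

/-- Points, and also tangent vectors, in the coordinates `(p, q, p₀, q₀, x₁, x₂, x₃, v)`. -/
@[ext] structure XSpace where
  p : ℝ
  q : ℝ
  p0 : ℝ
  q0 : ℝ
  x : Mink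
  v : ℝ

/-- Points, and also tangent vectors, in the coordinates `(p, q, p₀, q₀, y₁, y₂, y₃, v)`. -/
@[ext] structure YSpace where
  p : ℝ
  q : ℝ
  p0 : ℝ
  q0 : ℝ
  y : Mink
  v : ℝ

/-- The coordinate vector of a point. -/
def XSpace.coords (n : XSpace) : Fin 8 → ℝ :=
  ![n.p, n.q, n.p0, n.q0, n.x 0, n.x 1, n.x 2, n.v]

/-- The coordinate vector of a point. -/
def YSpace.coords (n : YSpace) : Fin 8 → ℝ :=
  ![n.p, n.q, n.p0, n.q0, n.y 0, n.y 1, n.y 2, n.v]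

/-- The velocity of a curve, component by component. -/
noncomputable def XSpace.velocity (σ : ℝ → XSpace) (t : ℝ) : XSpace where
  p := deriv (fun s => (σ s).p) t
  q := deriv (fun s => (σ s).q) t
  p0 := deriv (fun s => (σ s).p0) t
  q0 := deriv (fun s => (σ s).q0) t
  x := fun i => deriv (fun s => (σ s).x i) t
  v := deriv (fun s => (σ s).v) t

/-- The velocity of a curve, component by component. -/
noncomputable def YSpace.velocity (σ : ℝ → YSpace) (t : ℝ) : YSpace where
  p := deriv (fun s => (σ s).p) t
  q := deriv (fun s => (σ s).q) t
  p0 := deriv (fun s => (σ s).p0) t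
  q0 := deriv (fun s => (σ s).q0) t
  y := fun i => deriv (fun s => (σ s).y i) t
  v := deriv (fun s => (σ s).v) t

/-- The chart `φ(u, v, a, x)`, where `a = (a₁, a₂, a₃)` are the rational coordinates on the Lorentz
group. -/
noncomputable def phi (u v a₁ a₂ a₃ : ℝ) (x : Mink) : XSpace where
  p := (a₃ * (a₁ - a₂) - 1) / (a₁ - a₂)
  q := (a₃ * (a₁ + a₂) + 1) / (a₁ + a₂)
  p0 := Real.sqrt u * (a₁ - a₂) / Real.sqrt a₁
  q0 := Real.sqrt u * (a₁ + a₂) / Real.sqrt a₁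
  x := x
  v := v

/-- `N₁`, the image of the chart `φ`, whose domain is `u > 0`, `a₁ > 0`, `a₁ ± a₂ ≠ 0`. -/
def NOne : Set XSpace :=
  {n | ∃ (u v a₁ a₂ a₃ : ℝ) (x : Mink),
    0 < u ∧ 0 < a₁ ∧ a₁ - a₂ ≠ 0 ∧ a₁ + a₂ ≠ 0 ∧ phi u v a₁ a₂ a₃ x = n}

/-- The full region on which the coordinates `(p, q, p₀, q₀, x, v)` describe a point of `M` together
with an orthonormal frame of `ℝ^{1,2}` (see `XSpace.u` and `XSpace.frame`). It contains `N₁`; here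
`u` is nonzero but may be negative. -/
def NFull : Set XSpace := {n | n.p ≠ n.q ∧ n.p0 ≠ 0 ∧ n.q0 ≠ 0}

/-- The function `u` on `M` in the adapted coordinates. -/
noncomputable def XSpace.u (n : XSpace) : ℝ := -(1 / 2) * n.p0 * n.q0 * (n.p - n.q)

/-- The orthonormal frame `(e₁, e₂, e₃)` in the adapted coordinates. -/
noncomputable def XSpace.frame (n : XSpace) : Fin 3 → Mink :=
  ![![-(n.p0 ^ 2 * (n.p ^ 2 + 1) + n.q0 ^ 2 * (n.q ^ 2 + 1)) / (2 * n.p0 * n.q0 * (n.p - n.q)),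
      -(n.p0 ^ 2 * (n.p ^ 2 - 1) + n.q0 ^ 2 * (n.q ^ 2 - 1)) / (2 * n.p0 * n.q0 * (n.p - n.q)),
      (n.p0 ^ 2 * n.p + n.q0 ^ 2 * n.q) / (n.p0 * n.q0 * (n.p - n.q))],
    ![(n.p * n.q + 1) / (n.p - n.q),
      (n.p * n.q - 1) / (n.p - n.q),
      -(n.p + n.q) / (n.p - n.q)],
    ![-(n.p0 ^ 2 * (n.p ^ 2 + 1) - n.q0 ^ 2 * (n.q ^ 2 + 1)) / (2 * n.p0 * n.q0 * (n.p - n.q)),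
      -(n.p0 ^ 2 * (n.p ^ 2 - 1) - n.q0 ^ 2 * (n.q ^ 2 - 1)) / (2 * n.p0 * n.q0 * (n.p - n.q)),
      (n.p0 ^ 2 * n.p - n.q0 ^ 2 * n.q) / (n.p0 * n.q0 * (n.p - n.q))]]

/-- The diffeomorphism `ψ`. -/
noncomputable def psi (n : XSpace) : YSpace where
  p := n.p
  q := n.q
  p0 := n.p0
  q0 := n.q0
  y := ![n.x 0 - 1 / 8 * n.p0 ^ 2 * n.q0 ^ 2 * (n.p - n.q) * (1 + n.p * n.q),
         n.x 1 + 1 / 8 * n.p0 ^ 2 * n.q0 ^ 2 * (n.p - n.q) * (1 - n.p * n.q),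
         n.x 2 + 1 / 8 * n.p0 ^ 2 * n.q0 ^ 2 * (n.p ^ 2 - n.q ^ 2)]
  v := n.v

/-- The inverse of `ψ`. -/
noncomputable def psiInv (n : YSpace) : XSpace where
  p := n.p
  q := n.q
  p0 := n.p0
  q0 := n.q0
  x := ![n.y 0 + 1 / 8 * n.p0 ^ 2 * n.q0 ^ 2 * (n.p - n.q) * (1 + n.p * n.q),
         n.y 1 - 1 / 8 * n.p0 ^ 2 * n.q0 ^ 2 * (n.p - n.q) * (1 - n.p * n.q),
         n.y 2 - 1 / 8 * n.p0 ^ 2 * n.q0 ^ 2 * (n.p ^ 2 - n.q ^ 2)]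
  v := n.v

/-! ### The Pfaffian systems

Each system is given by generating 1-forms, evaluated at the point `n` on the tangent vector `w`. -/

/-- The singular system `V¹₊`. -/
noncomputable def VOnePlus (n w : XSpace) : Fin 6 → ℝ :=
  ![w.q, w.q0, w.v + 1 / 2 * n.p0 ^ 2 * w.p,
    w.x 0 + 1 / 8 * n.p0 ^ 2 *
        (n.p0 ^ 2 * (n.p ^ 2 + 1) + n.q0 ^ 2 * (n.q ^ 2 - 2 * n.p * n.q - 1)) * w.p
      - 1 / 4 * n.p0 * n.q0 ^ 2 * (n.p - n.q) * (n.p * n.q + 1) * w.p0,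
    w.x 1 + 1 / 8 * n.p0 ^ 2 *
        (n.p0 ^ 2 * (n.p ^ 2 - 1) + n.q0 ^ 2 * (n.q ^ 2 - 2 * n.p * n.q + 1)) * w.p
      - 1 / 4 * n.p0 * n.q0 ^ 2 * (n.p - n.q) * (n.p * n.q - 1) * w.p0,
    w.x 2 - 1 / 4 * n.p * n.p0 ^ 2 * (n.p0 ^ 2 - n.q0 ^ 2) * w.p
      + 1 / 4 * n.p0 * n.q0 ^ 2 * (n.p ^ 2 - n.q ^ 2) * w.p0]

/-- The singular system `V¹₋`. -/
noncomputable def VOneMinus (n w : XSpace) : Fin 6 → ℝ :=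
  ![w.p, w.p0, w.v - 1 / 2 * n.q0 ^ 2 * w.q,
    w.x 0 - 1 / 8 * n.q0 ^ 2 *
        (n.p0 ^ 2 * (n.p ^ 2 - 2 * n.p * n.q - 1) + n.q0 ^ 2 * (n.q ^ 2 + 1)) * w.q
      - 1 / 4 * n.p0 ^ 2 * n.q0 * (n.p - n.q) * (n.p * n.q + 1) * w.q0,
    w.x 1 - 1 / 8 * n.q0 ^ 2 *
        (n.p0 ^ 2 * (n.p ^ 2 - 2 * n.p * n.q + 1) + n.q0 ^ 2 * (n.q ^ 2 - 1)) * w.q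
      - 1 / 4 * n.p0 ^ 2 * n.q0 * (n.p - n.q) * (n.p * n.q - 1) * w.q0,
    w.x 2 - 1 / 4 * n.q * n.q0 ^ 2 * (n.p0 ^ 2 - n.q0 ^ 2) * w.q
      + 1 / 4 * n.p0 ^ 2 * n.q0 * (n.p ^ 2 - n.q ^ 2) * w.q0]

/-- The system `V¹ = V¹₊ ∩ V¹₋`. -/
noncomputable def VOne (n w : XSpace) : Fin 4 → ℝ :=
  ![w.v + 1 / 2 * n.p0 ^ 2 * w.p - 1 / 2 * n.q0 ^ 2 * w.q,
    w.x 0 + 1 / 8 * n.p0 ^ 2 *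
        (n.p0 ^ 2 * (n.p ^ 2 + 1) + n.q0 ^ 2 * (n.q ^ 2 - 2 * n.p * n.q - 1)) * w.p
      - 1 / 4 * n.p0 * n.q0 ^ 2 * (n.p - n.q) * (n.p * n.q + 1) * w.p0
      - 1 / 8 * n.q0 ^ 2 *
        (n.p0 ^ 2 * (n.p ^ 2 - 2 * n.p * n.q - 1) + n.q0 ^ 2 * (n.q ^ 2 + 1)) * w.q
      - 1 / 4 * n.p0 ^ 2 * n.q0 * (n.p - n.q) * (n.p * n.q + 1) * w.q0,
    w.x 1 + 1 / 8 * n.p0 ^ 2 *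
        (n.p0 ^ 2 * (n.p ^ 2 - 1) + n.q0 ^ 2 * (n.q ^ 2 - 2 * n.p * n.q + 1)) * w.p
      - 1 / 4 * n.p0 * n.q0 ^ 2 * (n.p - n.q) * (n.p * n.q - 1) * w.p0
      - 1 / 8 * n.q0 ^ 2 *
        (n.p0 ^ 2 * (n.p ^ 2 - 2 * n.p * n.q + 1) + n.q0 ^ 2 * (n.q ^ 2 - 1)) * w.q
      - 1 / 4 * n.p0 ^ 2 * n.q0 * (n.p - n.q) * (n.p * n.q - 1) * w.q0,
    w.x 2 - 1 / 4 * n.p * n.p0 ^ 2 * (n.p0 ^ 2 - n.q0 ^ 2) * w.p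
      + 1 / 4 * n.p0 * n.q0 ^ 2 * (n.p ^ 2 - n.q ^ 2) * w.p0
      - 1 / 4 * n.q * n.q0 ^ 2 * (n.p0 ^ 2 - n.q0 ^ 2) * w.q
      + 1 / 4 * n.p0 ^ 2 * n.q0 * (n.p ^ 2 - n.q ^ 2) * w.q0]

/-- The degree-one part of the embedding system `I²` on `N₂`. -/
noncomputable def VTwo (n w : YSpace) : Fin 4 → ℝ :=
  ![w.v + 1 / 2 * n.p0 ^ 2 * w.p - 1 / 2 * n.q0 ^ 2 * w.q,
    w.y 0 + 1 / 8 * n.p0 ^ 4 * (n.p ^ 2 + 1) * w.p - 1 / 8 * n.q0 ^ 4 * (n.q ^ 2 + 1) * w.q,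
    w.y 1 + 1 / 8 * n.p0 ^ 4 * (n.p ^ 2 - 1) * w.p - 1 / 8 * n.q0 ^ 4 * (n.q ^ 2 - 1) * w.q,
    w.y 2 - 1 / 4 * n.p * n.p0 ^ 4 * w.p + 1 / 4 * n.q * n.q0 ^ 4 * w.q]

/-- The 2-forms `dp ∧ dp₀` and `dq ∧ dq₀` that generate `I²` together with `VTwo`. -/
def twoForms (w z : YSpace) : Fin 2 → ℝ :=
  ![w.p * z.p0 - w.p0 * z.p, w.q * z.q0 - w.q0 * z.q]

/-- The 1-forms `ω³, ω¹ - η¹, ω² - η², ω¹₂ - η¹₂` of the isometric embedding system for the coframing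
`η¹ = u dv`, `η² = u du`, `η¹₂ = u⁻¹ dv`, at a point over `u` with orthonormal frame `e`, evaluated
on a tangent vector with components `du, dv, dx, de`. Here `dx = ∑ eᵢ ωⁱ` and `deⱼ = ∑ eᵢ ωⁱⱼ`. -/
noncomputable def embeddingForms (u : ℝ) (e : Fin 3 → Mink) (du dv : ℝ) (dx : Mink)
    (de : Fin 3 → Mink) : Fin 4 → ℝ :=
  ![-mink (e 2) dx, mink (e 0) dx - u * dv, -mink (e 1) dx - u * du,
    mink (e 0) (de 1) - u⁻¹ * dv]

/-- The curve in `M × F(ℝ^{1,2})` described by `σ` is an integral curve of the 1-forms of the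
isometric embedding system. -/
def IsEmbeddingIntegralCurve (J : Set ℝ) (σ : ℝ → XSpace) : Prop :=
  ∀ t ∈ J, embeddingForms (σ t).u (σ t).frame (deriv (fun s => (σ s).u) t)
    (deriv (fun s => (σ s).v) t) (fun i => deriv (fun s => (σ s).x i) t)
    (fun j i => deriv (fun s => (σ s).frame j i) t) = 0

/-- `σ` is a smooth integral curve of `V¹` over `J` in the region `N`. -/
structure IsIntegralCurveOne (J : Set ℝ) (N : Set XSpace) (σ : ℝ → XSpace) : Prop where
  smooth : ContDiffOn ℝ ∞ (fun t => (σ t).coords) J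
  mem : ∀ t ∈ J, σ t ∈ N
  integral : ∀ t ∈ J, VOne (σ t) (XSpace.velocity σ t) = 0

/-- The velocity lies in neither of the characteristic distributions `ann V¹₊`, `ann V¹₋`. -/
def IsNonCharacteristic (J : Set ℝ) (σ : ℝ → XSpace) : Prop :=
  ∀ t ∈ J, VOnePlus (σ t) (XSpace.velocity σ t) ≠ 0 ∧ VOneMinus (σ t) (XSpace.velocity σ t) ≠ 0

/-! ### The lift of the initial curve -/

/-- `x̄ᵢ'`. -/
noncomputable def vel (γ : ℝ → Mink) (i : Fin 3) (t : ℝ) : ℝ := deriv (fun s => γ s i) t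

/-- `x̄₁' - x̄₂'`. -/
noncomputable def velDiff (γ : ℝ → Mink) (t : ℝ) : ℝ := vel γ 0 t - vel γ 1 t

/-- `(x̄₁')² - (x̄₂')² - (x̄₃')²`. -/
noncomputable def velSq (γ : ℝ → Mink) (t : ℝ) : ℝ := vel γ 0 t ^ 2 - vel γ 1 t ^ 2 - vel γ 2 t ^ 2

/-- The second-order equation for `r = p₀ = q₀`. -/
def RadiusODE (γ : ℝ → Mink) (J : Set ℝ) (r : ℝ → ℝ) : Prop :=
  ∀ t ∈ J,
    velDiff γ t ^ 4 * r t * deriv (deriv r) t - 4 * velSq γ t * r t ^ 6 * deriv r t ^ 4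
      + 2 * velDiff γ t ^ 4 * deriv r t ^ 2
      - velDiff γ t ^ 3 * deriv (velDiff γ) t * r t * deriv r t = 0

/-- The constraint relation on a curve. -/
def ConstraintRelation (γ : ℝ → Mink) (I : Set ℝ) : Prop :=
  ∀ t ∈ I,
    -4 * velSq γ t * t ^ 6 + 2 * velDiff γ t ^ 4 - velDiff γ t ^ 3 * deriv (velDiff γ) t * t = 0

/-- The functions `p, p₀, q, q₀` of `σ` are obtained from a solution `r = p₀ = q₀` of the
second-order equation through
`s = (x̄₁' - x̄₂') / (2 r³ r')`, `p = x̄₃' / (x̄₂' - x̄₁') + s`, `q = x̄₃' / (x̄₂' - x̄₁') - s`. -/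
structure IsBuiltFromRadius (γ : ℝ → Mink) (J : Set ℝ) (σ : ℝ → XSpace) (r : ℝ → ℝ) : Prop where
  ode : RadiusODE γ J r
  ne_zero : ∀ t ∈ J, r t ≠ 0 ∧ deriv r t ≠ 0
  p0_eq : ∀ t ∈ J, (σ t).p0 = r t
  q0_eq : ∀ t ∈ J, (σ t).q0 = r t
  p_eq : ∀ t ∈ J, (σ t).p =
    vel γ 2 t / (vel γ 1 t - vel γ 0 t) + velDiff γ t / (2 * r t ^ 3 * deriv r t)
  q_eq : ∀ t ∈ J, (σ t).q =
    vel γ 2 t / (vel γ 1 t - vel γ 0 t) - velDiff γ t / (2 * r t ^ 3 * deriv r t)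

/-- `σ` is a non-characteristic lift of `γ` over `J` to an integral curve of `V¹` in `N`, built from
the solution `r = p₀ = q₀` of the second-order equation, whose vector `e₃` lies in the plane
`z₁ = z₂`. -/
structure IsLift (γ : ℝ → Mink) (J : Set ℝ) (N : Set XSpace) (σ : ℝ → XSpace) (r : ℝ → ℝ) :
    Prop where
  lifts : ∀ t ∈ J, (σ t).x = γ t
  integralCurve : IsIntegralCurveOne J N σ
  nonCharacteristic : IsNonCharacteristic J σ
  embeddingIntegral : IsEmbeddingIntegralCurve J σ
  lightlike : ∀ t ∈ J, (σ t).frame 2 0 = (σ t).frame 2 1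
  built : IsBuiltFromRadius γ J σ r

/-! ### Superposition -/

/-- The space `M̂₁` with coordinates `(p, p₀, v⁺, y⁺)`. -/
@[ext] structure HatPlus where
  p : ℝ
  p0 : ℝ
  v : ℝ
  y : Mink

/-- The space `M̂₂` with coordinates `(q, q₀, v⁻, y⁻)`. -/
@[ext] structure HatMinus where
  q : ℝ
  q0 : ℝ
  v : ℝ
  y : Mink

/-- The superposition formula `m * n`. -/
def superpose (m : HatPlus) (n : HatMinus) : YSpace where
  p := m.p
  q := n.q
  p0 := m.p0
  q0 := n.q0
  y := m.y + n.y
  v := m.v + n.v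

/-- Smooth integral curves of the restriction of the singular system `V²₊` to `M̂₁`. -/
structure IsIntegralPlus (J : Set ℝ) (σ : ℝ → HatPlus) : Prop where
  smooth : ContDiffOn ℝ ∞ (fun t => ((σ t).p, (σ t).p0, (σ t).v, (σ t).y)) J
  v_eq : ∀ t ∈ J, deriv (fun s => (σ s).v) t
    + 1 / 2 * (σ t).p0 ^ 2 * deriv (fun s => (σ s).p) t = 0
  y0_eq : ∀ t ∈ J, deriv (fun s => (σ s).y 0) t
    + 1 / 8 * (σ t).p0 ^ 4 * ((σ t).p ^ 2 + 1) * deriv (fun s => (σ s).p) t = 0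
  y1_eq : ∀ t ∈ J, deriv (fun s => (σ s).y 1) t
    + 1 / 8 * (σ t).p0 ^ 4 * ((σ t).p ^ 2 - 1) * deriv (fun s => (σ s).p) t = 0
  y2_eq : ∀ t ∈ J, deriv (fun s => (σ s).y 2) t
    - 1 / 4 * (σ t).p * (σ t).p0 ^ 4 * deriv (fun s => (σ s).p) t = 0

/-- Smooth integral curves of the restriction of the singular system `V²₋` to `M̂₂`. -/
structure IsIntegralMinus (J : Set ℝ) (σ : ℝ → HatMinus) : Prop where
  smooth : ContDiffOn ℝ ∞ (fun t => ((σ t).q, (σ t).q0, (σ t).v, (σ t).y)) J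
  v_eq : ∀ t ∈ J, deriv (fun s => (σ s).v) t
    - 1 / 2 * (σ t).q0 ^ 2 * deriv (fun s => (σ s).q) t = 0
  y0_eq : ∀ t ∈ J, deriv (fun s => (σ s).y 0) t
    - 1 / 8 * (σ t).q0 ^ 4 * ((σ t).q ^ 2 + 1) * deriv (fun s => (σ s).q) t = 0
  y1_eq : ∀ t ∈ J, deriv (fun s => (σ s).y 1) t
    - 1 / 8 * (σ t).q0 ^ 4 * ((σ t).q ^ 2 - 1) * deriv (fun s => (σ s).q) t = 0
  y2_eq : ∀ t ∈ J, deriv (fun s => (σ s).y 2) t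
    + 1 / 4 * (σ t).q * (σ t).q0 ^ 4 * deriv (fun s => (σ s).q) t = 0

/-- `σ = σ₊ * σ₋` over `J`, where `σ₊`, `σ₋` are integral curves of the singular systems. -/
structure IsDecomposition (J : Set ℝ) (σ : ℝ → YSpace) (σp : ℝ → HatPlus) (σm : ℝ → HatMinus) :
    Prop where
  plus : IsIntegralPlus J σp
  minus : IsIntegralMinus J σm
  eq : ∀ t ∈ J, σ t = superpose (σp t) (σm t)

/-- `S` is an immersed 2-dimensional integral manifold of `I²`, parametrized by `J × J`, in the
region `N`. -/
structure IsIntegralSurface (J : Set ℝ) (N : Set YSpace) (S : ℝ → ℝ → YSpace) : Prop where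
  smooth : ContDiffOn ℝ ∞ (fun t : ℝ × ℝ => (S t.1 t.2).coords) (J ×ˢ J)
  mem : ∀ t₁ ∈ J, ∀ t₂ ∈ J, S t₁ t₂ ∈ N
  oneForms₁ : ∀ t₁ ∈ J, ∀ t₂ ∈ J, VTwo (S t₁ t₂) (YSpace.velocity (fun t => S t t₂) t₁) = 0
  oneForms₂ : ∀ t₁ ∈ J, ∀ t₂ ∈ J, VTwo (S t₁ t₂) (YSpace.velocity (fun t => S t₁ t) t₂) = 0
  twoForms : ∀ t₁ ∈ J, ∀ t₂ ∈ J,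
    twoForms (YSpace.velocity (fun t => S t t₂) t₁) (YSpace.velocity (fun t => S t₁ t) t₂) = 0
  immersion : ∀ t₁ ∈ J, ∀ t₂ ∈ J,
    LinearIndependent ℝ ![(YSpace.velocity (fun t => S t t₂) t₁).coords,
      (YSpace.velocity (fun t => S t₁ t) t₂).coords]

/-- The decomposition of `σ` into characteristic curves exists, it is unique up to constants of
integration, and all decompositions give the same integral surface `(t₁, t₂) ↦ σ₊(t₁) * σ₋(t₂)` of
`I²` in `N`. -/
structure HasUniqueDecomposition (J : Set ℝ) (N : Set YSpace) (σ : ℝ → YSpace) : Prop where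
  exist : ∃ σp σm, IsDecomposition J σ σp σm
  surface : ∀ σp σm, IsDecomposition J σ σp σm →
    IsIntegralSurface J N (fun t₁ t₂ => superpose (σp t₁) (σm t₂))
  unique_up_to_constants : ∀ σp σm τp τm,
    IsDecomposition J σ σp σm → IsDecomposition J σ τp τm →
    ∃ (c : ℝ) (k : Mink), ∀ t ∈ J,
      τp t = ⟨(σp t).p, (σp t).p0, (σp t).v + c, (σp t).y + k⟩ ∧
      τm t = ⟨(σm t).q, (σm t).q0, (σm t).v - c, (σm t).y - k⟩
  surface_unique : ∀ σp σm τp τm,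
    IsDecomposition J σ σp σm → IsDecomposition J σ τp τm →
    ∀ t₁ ∈ J, ∀ t₂ ∈ J, superpose (σp t₁) (σm t₂) = superpose (τp t₁) (τm t₂)

/-- The surface `S` in `N₂`, parametrized by `J × J`, defines an isometric embedding of an open
subset of `(M, g₀)` whose image contains `γ(J)`: the map `(t₁, t₂) ↦ (u, v)` is a diffeomorphism `e`
of `J × J` onto an open set, and `π ∘ ψ⁻¹ ∘ S ∘ e⁻¹` is an isometric embedding of that set. -/
def DefinesEmbedding (γ : ℝ → Mink) (J : Set ℝ) (S : ℝ → ℝ → YSpace) : Prop :=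
  ∃ e : OpenPartialHomeomorph (ℝ × ℝ) (ℝ × ℝ),
    e.source = J ×ˢ J ∧
    (∀ t₁ ∈ J, ∀ t₂ ∈ J, e (t₁, t₂) = ((psiInv (S t₁ t₂)).u, (psiInv (S t₁ t₂)).v)) ∧
    ContDiffOn ℝ ∞ e e.source ∧ ContDiffOn ℝ ∞ e.symm e.target ∧
    IsIsometricEmbedding e.target (fun m => (psiInv (S (e.symm m).1 (e.symm m).2)).x) ∧
    γ '' J ⊆ (fun m => (psiInv (S (e.symm m).1 (e.symm m).2)).x) '' e.target

/-- The independence condition at `t₀`: the derivative of `x̄₃' / (x̄₁' - x̄₂')` does not vanish. -/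
def IsIndependentAt (γ : ℝ → Mink) (t₀ : ℝ) : Prop :=
  deriv (fun t => vel γ 2 t / velDiff γ t) t₀ ≠ 0

/-- The lift `σ`, its decomposition into characteristic curves, and the isometric embedding that
these curves define, over the interval `J` around `t₀`. -/
structure SolvesCauchyProblem (γ : ℝ → Mink) (t₀ : ℝ) (J : Set ℝ) (N : Set XSpace)
    (σ : ℝ → XSpace) (r : ℝ → ℝ) : Prop where
  lift : IsLift γ J N σ r
  decomposition : HasUniqueDecomposition J (psi '' N) (fun t => psi (σ t))
  embedding : IsIndependentAt γ t₀ →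
    ∀ σp σm, IsDecomposition J (fun t => psi (σ t)) σp σm →
      DefinesEmbedding γ J (fun t₁ t₂ => superpose (σp t₁) (σm t₂))

/-! ### Quadratures -/

/-- Functions on `J` obtained by quadratures from the curve `γ`: starting with the constants, the
parameter `t`, and the functions `x̄ᵢ, x̄ᵢ', x̄ᵢ''`, one may add, multiply, take reciprocals of
functions without zeros on `J`, and take antiderivatives. -/
inductive ByQuadratures (γ : ℝ → Mink) (J : Set ℝ) : (ℝ → ℝ) → Prop
  | const (c : ℝ) : ByQuadratures γ J (fun _ => c)
  | param : ByQuadratures γ J (fun t => t)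
  | coord (i : Fin 3) : ByQuadratures γ J (fun t => γ t i)
  | coord_deriv (i : Fin 3) : ByQuadratures γ J (vel γ i)
  | coord_deriv_deriv (i : Fin 3) : ByQuadratures γ J (deriv (vel γ i))
  | add {f g : ℝ → ℝ} : ByQuadratures γ J f → ByQuadratures γ J g →
      ByQuadratures γ J (fun t => f t + g t)
  | mul {f g : ℝ → ℝ} : ByQuadratures γ J f → ByQuadratures γ J g →
      ByQuadratures γ J (fun t => f t * g t)
  | inv {f : ℝ → ℝ} : ByQuadratures γ J f → (∀ t ∈ J, f t ≠ 0) →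
      ByQuadratures γ J (fun t => (f t)⁻¹)
  | integral {f F : ℝ → ℝ} : ByQuadratures γ J f → (∀ t ∈ J, HasDerivAt F (f t) t) →
      ByQuadratures γ J F
  | congr {f g : ℝ → ℝ} : ByQuadratures γ J f → Set.EqOn f g J → ByQuadratures γ J g

/-- All coordinate functions of `σ` and of the characteristic curves in its decompositions are
obtained by quadratures from `γ`. -/
structure SolvedByQuadratures (γ : ℝ → Mink) (J : Set ℝ) (σ : ℝ → XSpace) : Prop where
  lift : ∀ i, ByQuadratures γ J (fun t => (σ t).coords i)
  plus : ∀ σp σm, IsDecomposition J (fun t => psi (σ t)) σp σm →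
    ByQuadratures γ J (fun t => (σp t).p) ∧ ByQuadratures γ J (fun t => (σp t).p0) ∧
    ByQuadratures γ J (fun t => (σp t).v) ∧ ∀ i, ByQuadratures γ J (fun t => (σp t).y i)
  minus : ∀ σp σm, IsDecomposition J (fun t => psi (σ t)) σp σm →
    ByQuadratures γ J (fun t => (σm t).q) ∧ ByQuadratures γ J (fun t => (σm t).q0) ∧
    ByQuadratures γ J (fun t => (σm t).v) ∧ ∀ i, ByQuadratures γ J (fun t => (σm t).y i)

end CauchyEmbedding

open CauchyEmbedding

/-! ### Smooth functions on open sets -/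

/-! Write D = x̄₁' - x̄₂'. The vector e₃ has equal first and second components exactly when p₀² =
q₀², and the lift is sought with p₀ = q₀ = r, p = m + s, q = m - s. The four equations of V¹ then
separate. The difference of the x₁- and x₂-equations reads D = 2r³r's and fixes s; the x₃-equation
reads x̄₃' = -mD and fixes m; the dv-equation reads v' = -r²s' and gives v by an integration. What
is left is the sum of the x₁- and x₂-equations. Multiplied by D it prescribes x̄₁'² - x̄₂'² - x̄₃'²,
and with s eliminated it is the second-order equation for r. A local solution of that equation
therefore yields the lift (`velSq_eq_of_radiusODE`, `isIntegralCurveOne_radiusLift`,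
`exists_radiusODE_solution`). Along the lift u = -r²s = -D/(2rr'), so the initial values of r and r'
control the sign of u.

The map ψ removes the mixed terms: in the y-coordinates each 1-form is a part in p, p₀ plus a part
in q, q₀ (`VTwo_psi`). Integrating the first parts along the curve gives σ₊, and the remainder is σ₋
(`exists_isDecomposition`). The only freedom is constants of integration, which cancel in σ₊(t₁) *
σ₋(t₂). Freezing one parameter leaves a characteristic curve in the other, so the superposition is
an integral surface.

The isometry is a polynomial identity between the partial derivatives of x and those of (u, v)
(`mink_eq_gZero_of_partials`). At (t₀, t₀) the Jacobian determinants of (u, v) and of (x₁, x₂) are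
both nonzero multiples of p' + q' = 2m', where m = -x̄₃'/D; this is the independence condition. The
first determinant makes (u, v) coordinates on a small square. The second makes the surface a graph
over the (x₁, x₂)-plane, hence embedded (`exists_definesEmbedding`, `isIsometricEmbedding_surface`).

The constraint relation says that r = ±t solves the second-order equation. Then p and q are rational
in t and the x̄ᵢ', their derivatives involve only x̄ᵢ'' in addition, and everything else is an
integral. -/

theorem ContDiffOn.hasDerivAt_of_isOpen {E : Type*} [NormedAddCommGroup E] [NormedSpace ℝ E]
    {f : ℝ → E} {J : Set ℝ} (hf : ContDiffOn ℝ ∞ f J) (hJ : IsOpen J) {t : ℝ} (ht : t ∈ J) :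
    HasDerivAt f (deriv f t) t :=
  ((hf.contDiffAt (hJ.mem_nhds ht)).differentiableAt (by simp)).hasDerivAt

theorem ContDiffOn.deriv_infty {E : Type*} [NormedAddCommGroup E] [NormedSpace ℝ E]
    {f : ℝ → E} {J : Set ℝ} (hf : ContDiffOn ℝ ∞ f J) (hJ : IsOpen J) :
    ContDiffOn ℝ ∞ (deriv f) J :=
  ((contDiffOn_infty_iff_deriv_of_isOpen hJ).1 hf).2

theorem deriv_eq_of_eqOn_isOpen {E : Type*} [NormedAddCommGroup E] [NormedSpace ℝ E]
    {f g : ℝ → E} {J : Set ℝ} (h : Set.EqOn f g J) (hJ : IsOpen J) {t : ℝ} (ht : t ∈ J) :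
    deriv f t = deriv g t :=
  Filter.EventuallyEq.deriv_eq (Filter.mem_of_superset (hJ.mem_nhds ht) h)

theorem contDiffOn_infty_of_hasDerivAt {E : Type*} [NormedAddCommGroup E] [NormedSpace ℝ E]
    {f f' : ℝ → E} {J : Set ℝ} (hJ : IsOpen J) (hf : ∀ t ∈ J, HasDerivAt f (f' t) t)
    (hf' : ContDiffOn ℝ ∞ f' J) : ContDiffOn ℝ ∞ f J :=
  (contDiffOn_infty_iff_deriv_of_isOpen hJ).2
    ⟨fun t ht => (hf t ht).differentiableAt.differentiableWithinAt,
      hf'.congr fun t ht => (hf t ht).deriv⟩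

/-- A continuous function on an open interval has an antiderivative there. -/
theorem exists_antiderivative {f : ℝ → ℝ} {α β : ℝ} (hf : ContinuousOn f (Set.Ioo α β)) :
    ∃ F : ℝ → ℝ, ∀ t ∈ Set.Ioo α β, HasDerivAt F (f t) t := by
  rcases (Set.Ioo α β).eq_empty_or_nonempty with h | ⟨c, hc⟩
  · exact ⟨0, by simp [h]⟩
  refine ⟨fun t => ∫ x in c..t, f x, fun t ht => ?_⟩
  have hsub : Set.uIcc c t ⊆ Set.Ioo α β := Set.ordConnected_Ioo.uIcc_subset hc ht
  exact intervalIntegral.integral_hasDerivAt_right ((hf.mono hsub).intervalIntegrable)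
    (hf.stronglyMeasurableAtFilter isOpen_Ioo t ht) (hf.continuousAt (isOpen_Ioo.mem_nhds ht))

/-- Two functions with the same derivative on an open interval differ by a constant. -/
theorem exists_eq_add_const_of_hasDerivAt {f g f' : ℝ → ℝ} {α β : ℝ}
    (hf : ∀ t ∈ Set.Ioo α β, HasDerivAt f (f' t) t)
    (hg : ∀ t ∈ Set.Ioo α β, HasDerivAt g (f' t) t) :
    ∃ c, ∀ t ∈ Set.Ioo α β, g t = f t + c := by
  obtain ⟨c, hc⟩ := isOpen_Ioo.exists_is_const_of_deriv_eq_zero (𝕜 := ℝ) (f := fun t => g t - f t)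
    isPreconnected_Ioo
    (fun t ht => ((hg t ht).sub (hf t ht)).differentiableAt.differentiableWithinAt)
    (fun t ht => ((hg t ht).sub (hf t ht)).deriv.trans (sub_self _))
  exact ⟨c, fun t ht => by linarith [hc t ht]⟩

/-! ### Ordinary differential equations -/

/-- Local existence and smoothness of integral curves of a smooth vector field. -/
theorem exists_smooth_integralCurve {E : Type*} [NormedAddCommGroup E] [NormedSpace ℝ E]
    [CompleteSpace E] {V : E → E} {O : Set E} (hO : IsOpen O) (hV : ContDiffOn ℝ ∞ V O) {x₀ : E}
    (hx₀ : x₀ ∈ O) (t₀ : ℝ) :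
    ∃ (z : ℝ → E) (ε : ℝ), 0 < ε ∧ z t₀ = x₀ ∧
      (∀ t ∈ Set.Ioo (t₀ - ε) (t₀ + ε), z t ∈ O ∧ HasDerivAt z (V (z t)) t) ∧
      ContDiffOn ℝ ∞ z (Set.Ioo (t₀ - ε) (t₀ + ε)) := by
  have hV₁ : ContDiffAt ℝ 1 V x₀ := (hV.contDiffAt (hO.mem_nhds hx₀)).of_le (by simp)
  obtain ⟨z, hz₀, ε, hε, hz⟩ :=
    hV₁.exists_forall_mem_closedBall_exists_eq_forall_mem_Ioo_hasDerivAt₀ t₀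
  have hcont : ContinuousAt z t₀ := (hz t₀ (by simp [hε])).continuousAt
  obtain ⟨δ, hδ, hδO⟩ := Metric.mem_nhds_iff.1 (hcont.preimage_mem_nhds (hO.mem_nhds (hz₀ ▸ hx₀)))
  -- Halving leaves room for the closed interval: the smoothness theorem for solutions is applied on
  -- `Icc` and then restricted.
  set η := min (ε / 2) (δ / 2) with hη
  have hη₀ : 0 < η := by positivity
  have hηε : η ≤ ε / 2 := min_le_left _ _
  have hηδ : η ≤ δ / 2 := min_le_right _ _
  have key : ∀ t ∈ Set.Icc (t₀ - η) (t₀ + η), z t ∈ O ∧ HasDerivAt z (V (z t)) t := by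
    intro t ht
    refine ⟨hδO ?_, hz t ⟨by linarith [ht.1], by linarith [ht.2]⟩⟩
    rw [Metric.mem_ball, Real.dist_eq, abs_lt]
    constructor <;> linarith [ht.1, ht.2]
  refine ⟨z, η, hη₀, hz₀, fun t ht => key t (Set.Ioo_subset_Icc_self ht), ?_⟩
  refine (ODE.contDiffOn_enat_Icc_of_hasDerivWithinAt (n := ⊤) (f := fun _ => V) (u := O) ?_
    (fun t ht => (key t ht).2.hasDerivWithinAt) fun t ht => (key t ht).1).mono
      Set.Ioo_subset_Icc_self
  exact hV.comp contDiffOn_snd fun x hx => hx.2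

/-- Local existence and smoothness of solutions of a smooth second-order equation. -/
theorem exists_smooth_solution_secondOrder {G : ℝ × ℝ × ℝ → ℝ} {O : Set (ℝ × ℝ × ℝ)}
    (hO : IsOpen O) (hG : ContDiffOn ℝ ∞ G O) {t₀ r₀ r₁ : ℝ} (h₀ : (t₀, r₀, r₁) ∈ O) :
    ∃ (r : ℝ → ℝ) (ε : ℝ), 0 < ε ∧ r t₀ = r₀ ∧ deriv r t₀ = r₁ ∧
      ContDiffOn ℝ ∞ r (Set.Ioo (t₀ - ε) (t₀ + ε)) ∧
      ∀ t ∈ Set.Ioo (t₀ - ε) (t₀ + ε), (t, r t, deriv r t) ∈ O ∧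
        deriv (deriv r) t = G (t, r t, deriv r t) := by
  -- The equation becomes an autonomous first-order system for (t, r, r'). That the first component
  -- really is t is recovered afterwards from its derivative 1 and its initial value.
  obtain ⟨z, ε, hε, hz₀, hz, hsm⟩ := exists_smooth_integralCurve
    (V := fun x : ℝ × ℝ × ℝ => ((1 : ℝ), x.2.2, G x)) hO
    (contDiffOn_const.prodMk (contDiffOn_snd.snd.prodMk hG)) h₀ t₀
  have ht₀ : t₀ ∈ Set.Ioo (t₀ - ε) (t₀ + ε) := by simp [hε]
  have h1 : ∀ t ∈ Set.Ioo (t₀ - ε) (t₀ + ε), HasDerivAt (fun t => (z t).1) 1 t :=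
    fun t ht => ((hasFDerivAt_fst (p := z t)).comp_hasDerivAt t (hz t ht).2)
  have h2 : ∀ t ∈ Set.Ioo (t₀ - ε) (t₀ + ε), HasDerivAt (fun t => (z t).2.1) (z t).2.2 t :=
    fun t ht => (((ContinuousLinearMap.fst ℝ ℝ ℝ).comp
      (ContinuousLinearMap.snd ℝ ℝ (ℝ × ℝ))).hasFDerivAt.comp_hasDerivAt t (hz t ht).2)
  have h3 : ∀ t ∈ Set.Ioo (t₀ - ε) (t₀ + ε), HasDerivAt (fun t => (z t).2.2) (G (z t)) t :=
    fun t ht => (((ContinuousLinearMap.snd ℝ ℝ ℝ).comp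
      (ContinuousLinearMap.snd ℝ ℝ (ℝ × ℝ))).hasFDerivAt.comp_hasDerivAt t (hz t ht).2)
  obtain ⟨c, hc⟩ := exists_eq_add_const_of_hasDerivAt h1 fun t _ => hasDerivAt_id t
  have hc₀ : c = 0 := by
    have := hc t₀ ht₀
    simp only [id, hz₀] at this
    linarith
  have hd : Set.EqOn (deriv fun t => (z t).2.1) (fun t => (z t).2.2)
      (Set.Ioo (t₀ - ε) (t₀ + ε)) := fun t ht => (h2 t ht).deriv
  have hzt : ∀ t ∈ Set.Ioo (t₀ - ε) (t₀ + ε),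
      (t, (z t).2.1, deriv (fun t => (z t).2.1) t) = z t := fun t ht =>
    Prod.ext (by simpa [hc₀] using hc t ht) (Prod.ext rfl (hd ht))
  refine ⟨fun t => (z t).2.1, ε, hε, by simp [hz₀], by simp [hd ht₀, hz₀], hsm.snd.fst,
    fun t ht => ?_⟩
  rw [hzt t ht, deriv_eq_of_eqOn_isOpen hd isOpen_Ioo ht]
  exact ⟨(hz t ht).1, (h3 t ht).deriv⟩

/-! ### Smooth maps of the plane -/

theorem fderiv_apply_of_partials {E : Type*} [NormedAddCommGroup E] [NormedSpace ℝ E]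
    {F : ℝ × ℝ → E} {a : ℝ × ℝ} {A B : E} (hF : DifferentiableAt ℝ F a)
    (hA : HasDerivAt (fun t => F (t, a.2)) A a.1) (hB : HasDerivAt (fun t => F (a.1, t)) B a.2)
    (w : ℝ × ℝ) : fderiv ℝ F a w = w.1 • A + w.2 • B := by
  have h1 : HasDerivAt (fun t => F (t, a.2)) (fderiv ℝ F a (1, 0)) a.1 :=
    hF.hasFDerivAt.comp_hasDerivAt a.1 ((hasDerivAt_id a.1).prodMk (hasDerivAt_const a.1 a.2))
  have h2 : HasDerivAt (fun t => F (a.1, t)) (fderiv ℝ F a (0, 1)) a.2 :=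
    hF.hasFDerivAt.comp_hasDerivAt a.2 ((hasDerivAt_const a.2 a.1).prodMk (hasDerivAt_id a.2))
  rw [hA.unique h1, hB.unique h2, ← map_smul, ← map_smul, ← map_add]
  simp

/-- The inverse function theorem in the plane: near a point where the Jacobian determinant of `F`
does not vanish, `F` restricts to a diffeomorphism on every smaller open set. -/
theorem exists_openPartialHomeomorph_of_jacobian {F : ℝ × ℝ → ℝ × ℝ} {O : Set (ℝ × ℝ)}
    (hO : IsOpen O) (hF : ContDiffOn ℝ ∞ F O) {a A B : ℝ × ℝ} (ha : a ∈ O)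
    (hA : HasDerivAt (fun t => F (t, a.2)) A a.1) (hB : HasDerivAt (fun t => F (a.1, t)) B a.2)
    (hdet : A.1 * B.2 - B.1 * A.2 ≠ 0) :
    ∃ V : Set (ℝ × ℝ), IsOpen V ∧ a ∈ V ∧ V ⊆ O ∧ ∀ W ⊆ V, IsOpen W →
      ∃ e : OpenPartialHomeomorph (ℝ × ℝ) (ℝ × ℝ), e.source = W ∧ ⇑e = F ∧
        ContDiffOn ℝ ∞ e.symm e.target := by
  have hFa : ContDiffAt ℝ ∞ F a := hF.contDiffAt (hO.mem_nhds ha)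
  have hinj : Function.Injective (fderiv ℝ F a) := by
    rw [injective_iff_map_eq_zero]
    intro w hw
    rw [fderiv_apply_of_partials (hFa.differentiableAt (by simp)) hA hB] at hw
    have e1 : w.1 * A.1 + w.2 * B.1 = 0 := by simpa using congrArg Prod.fst hw
    have e2 : w.1 * A.2 + w.2 * B.2 = 0 := by simpa using congrArg Prod.snd hw
    refine Prod.ext (mul_right_cancel₀ hdet ?_) (mul_right_cancel₀ hdet ?_)
    · simp only [Prod.fst_zero]
      linear_combination B.2 * e1 - B.1 * e2
    · simp only [Prod.snd_zero]
      linear_combination A.1 * e2 - A.2 * e1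
  let L : (ℝ × ℝ) ≃L[ℝ] (ℝ × ℝ) :=
    (LinearEquiv.ofInjectiveEndo (fderiv ℝ F a : (ℝ × ℝ) →ₗ[ℝ] (ℝ × ℝ)) hinj).toContinuousLinearEquiv
  have hL : (L : (ℝ × ℝ) →L[ℝ] (ℝ × ℝ)) = fderiv ℝ F a := by
    ext <;> rfl
  have hd : HasFDerivAt F (L : (ℝ × ℝ) →L[ℝ] (ℝ × ℝ)) a :=
    hL ▸ (hFa.differentiableAt (by simp)).hasFDerivAt
  set e₀ := hFa.toOpenPartialHomeomorph F hd (by simp)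
  have hcont : ContinuousOn (fderiv ℝ F) O :=
    (hF.fderiv_of_isOpen (m := 0) hO (by simp)).continuousOn
  -- The inverse is smooth at the image of every point where the derivative is invertible, which is
  -- an open condition. Intersecting with this set gives smoothness on the whole target.
  have hI : IsOpen (O ∩ fderiv ℝ F ⁻¹' Set.range
      (fun L : (ℝ × ℝ) ≃L[ℝ] (ℝ × ℝ) => (L : (ℝ × ℝ) →L[ℝ] (ℝ × ℝ)))) :=
    hcont.isOpen_inter_preimage hO (ContinuousLinearEquiv.isOpen (𝕜 := ℝ))
  refine ⟨e₀.source ∩ (O ∩ fderiv ℝ F ⁻¹' Set.range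
      (fun L : (ℝ × ℝ) ≃L[ℝ] (ℝ × ℝ) => (L : (ℝ × ℝ) →L[ℝ] (ℝ × ℝ)))), e₀.open_source.inter hI,
    ⟨hFa.mem_toOpenPartialHomeomorph_source hd (by simp), ha, L, hL⟩, fun x hx => hx.2.1,
    fun W hW hWo => ⟨e₀.restrOpen W hWo, ?_, rfl, fun m hm => ?_⟩⟩
  · rw [OpenPartialHomeomorph.restrOpen_source]
    exact Set.inter_eq_right.2 fun x hx => (hW hx).1
  · have hx := (e₀.restrOpen W hWo).map_target hm
    rw [OpenPartialHomeomorph.restrOpen_source] at hx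
    obtain ⟨-, hxO, L', hL'⟩ := hW hx.2
    have hFx : ContDiffAt ℝ ∞ F ((e₀.restrOpen W hWo).symm m) := hF.contDiffAt (hO.mem_nhds hxO)
    refine ((e₀.restrOpen W hWo).contDiffAt_symm (f₀' := L') hm ?_ hFx).contDiffWithinAt
    exact (show (L' : (ℝ × ℝ) →L[ℝ] (ℝ × ℝ)) = _ from hL') ▸
      (hFx.differentiableAt (by simp)).hasFDerivAt

/-! ### Curves in the coordinate spaces -/

theorem CauchyEmbedding.XSpace.contDiffOn_coords_iff {E : Type*} [NormedAddCommGroup E]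
    [NormedSpace ℝ E] {σ : E → XSpace} {J : Set E} :
    ContDiffOn ℝ ∞ (fun t => (σ t).coords) J ↔
      ContDiffOn ℝ ∞ (fun t => (σ t).p) J ∧ ContDiffOn ℝ ∞ (fun t => (σ t).q) J ∧
      ContDiffOn ℝ ∞ (fun t => (σ t).p0) J ∧ ContDiffOn ℝ ∞ (fun t => (σ t).q0) J ∧
      (∀ i, ContDiffOn ℝ ∞ (fun t => (σ t).x i) J) ∧ ContDiffOn ℝ ∞ (fun t => (σ t).v) J := by
  simp only [contDiffOn_pi, XSpace.coords, Fin.forall_fin_succ, IsEmpty.forall_iff, and_true]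
  simp [and_assoc]

theorem CauchyEmbedding.YSpace.contDiffOn_coords_iff {E : Type*} [NormedAddCommGroup E]
    [NormedSpace ℝ E] {σ : E → YSpace} {J : Set E} :
    ContDiffOn ℝ ∞ (fun t => (σ t).coords) J ↔
      ContDiffOn ℝ ∞ (fun t => (σ t).p) J ∧ ContDiffOn ℝ ∞ (fun t => (σ t).q) J ∧
      ContDiffOn ℝ ∞ (fun t => (σ t).p0) J ∧ ContDiffOn ℝ ∞ (fun t => (σ t).q0) J ∧
      (∀ i, ContDiffOn ℝ ∞ (fun t => (σ t).y i) J) ∧ ContDiffOn ℝ ∞ (fun t => (σ t).v) J := by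
  simp only [contDiffOn_pi, YSpace.coords, Fin.forall_fin_succ, IsEmpty.forall_iff, and_true]
  simp [and_assoc]

theorem vec4_eq_zero {a b c d : ℝ} (ha : a = 0) (hb : b = 0) (hc : c = 0) (hd : d = 0) :
    ![a, b, c, d] = 0 := by
  subst ha hb hc hd
  ext i
  fin_cases i <;> rfl

/-- The region `N₁` in terms of the coordinates on `N`. -/
theorem mem_NOne_iff (n : XSpace) :
    n ∈ NOne ↔ 0 < n.u ∧ 0 < n.p0 + n.q0 ∧ n.p0 ≠ 0 ∧ n.q0 ≠ 0 := by
  constructor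
  · rintro ⟨u, v, a₁, a₂, a₃, x, hu, ha₁, hm, hp, rfl⟩
    have hsa : 0 < Real.sqrt a₁ := Real.sqrt_pos.2 ha₁
    have hsu : 0 < Real.sqrt u := Real.sqrt_pos.2 hu
    have hu' : (phi u v a₁ a₂ a₃ x).u = u := by
      simp only [XSpace.u, phi]
      field_simp
      rw [Real.sq_sqrt hu.le, Real.sq_sqrt ha₁.le]
      ring
    refine ⟨hu'.symm ▸ hu, ?_, ?_, ?_⟩
    · simp only [phi]
      rw [← add_div]
      apply div_pos _ hsa
      nlinarith [mul_pos hsu ha₁]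
    · simp only [phi]
      positivity
    · simp only [phi]
      positivity
  · rintro ⟨hu, hs, hp, hq⟩
    have hsu : 0 < Real.sqrt n.u := Real.sqrt_pos.2 hu
    have hpq : n.p - n.q ≠ 0 := by
      intro h
      simp [XSpace.u, h] at hu
    have hu2 : Real.sqrt n.u ^ 2 = -(1 / 2) * n.p0 * n.q0 * (n.p - n.q) := Real.sq_sqrt hu.le
    set w := Real.sqrt n.u with hw
    -- Here b plays the role of √a₁, since p₀ + q₀ = 2√u√a₁ in the chart. Likewise q₀ - p₀ = 2√u
    -- a₂/√a₁ gives a₂, and the formula for p gives a₃. The formula for q then holds because of the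
    -- value of u.
    obtain ⟨b, hb₀, hbw⟩ : ∃ b, 0 < b ∧ 2 * w * b = n.p0 + n.q0 :=
      ⟨(n.p0 + n.q0) / (2 * w), by positivity, by field_simp⟩
    have hsb : Real.sqrt (b ^ 2) = b := Real.sqrt_sq hb₀.le
    refine ⟨n.u, n.v, b ^ 2, b * (n.q0 - n.p0) / (2 * w), n.p + w / (n.p0 * b), n.x, hu,
      by positivity, ?_, ?_, ?_⟩
    all_goals
      have e1 : b ^ 2 - b * (n.q0 - n.p0) / (2 * w) = b * n.p0 / w := by
        field_simp
        linear_combination hbw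
      have e2 : b ^ 2 + b * (n.q0 - n.p0) / (2 * w) = b * n.q0 / w := by
        field_simp
        linear_combination hbw
    · rw [e1]; positivity
    · rw [e2]; positivity
    · ext
      · simp only [phi, e1]
        field_simp
        ring
      · simp only [phi, e2]
        field_simp
        linear_combination 2 * b * hu2 - w * hbw
      · simp only [phi, e1, hsb]
        rw [← hw]
        field_simp
      · simp only [phi, e2, hsb]
        rw [← hw]
        field_simp
      · rfl
      · rfl

theorem NOne_subset_NFull : NOne ⊆ NFull := by
  intro n hn
  rw [mem_NOne_iff] at hn
  refine ⟨fun h => ?_, hn.2.2⟩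
  simp [XSpace.u, h] at hn

theorem psiInv_psi (n : XSpace) : psiInv (psi n) = n := by
  ext i <;> try rfl
  fin_cases i <;> simp [psiInv, psi]

theorem psi_psiInv (n : YSpace) : psi (psiInv n) = n := by
  ext i <;> try rfl
  fin_cases i <;> simp [psiInv, psi]

theorem mem_psi_image_iff {N : Set XSpace} {n : YSpace} : n ∈ psi '' N ↔ psiInv n ∈ N :=
  ⟨by rintro ⟨m, hm, rfl⟩; rwa [psiInv_psi], fun h => ⟨_, h, psi_psiInv n⟩⟩

/-- Integral curves of `V¹` are integral curves of the isometric embedding system. -/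
theorem CauchyEmbedding.IsIntegralCurveOne.isEmbeddingIntegralCurve {J : Set ℝ} (hJ : IsOpen J)
    {N : Set XSpace} (hN : N ⊆ NFull) {σ : ℝ → XSpace} (h : IsIntegralCurveOne J N σ) :
    IsEmbeddingIntegralCurve J σ := by
  intro t ht
  obtain ⟨sp, sq, sp0, sq0, -, -⟩ := XSpace.contDiffOn_coords_iff.1 h.smooth
  have dp := sp.hasDerivAt_of_isOpen hJ ht
  have dq := sq.hasDerivAt_of_isOpen hJ ht
  have dp0 := sp0.hasDerivAt_of_isOpen hJ ht
  have dq0 := sq0.hasDerivAt_of_isOpen hJ ht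
  obtain ⟨hpq, hp0, hq0⟩ := hN (h.mem t ht)
  rw [← sub_ne_zero] at hpq
  have hV := h.integral t ht
  have h0 := congrFun hV 0
  have h1 := congrFun hV 1
  have h2 := congrFun hV 2
  have h3 := congrFun hV 3
  simp only [VOne, XSpace.velocity, Matrix.cons_val, Pi.zero_apply] at h0 h1 h2 h3
  have du := (((dp0.const_mul (-(1 / 2) : ℝ)).mul dq0).mul (dp.sub dq)).deriv
  have f0 := (((dp.mul dq).add_const 1).div (dp.sub dq) hpq).deriv
  have f1 := (((dp.mul dq).sub_const 1).div (dp.sub dq) hpq).deriv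
  have f2 := ((dp.add dq).neg.div (dp.sub dq) hpq).deriv
  replace du : deriv (fun s => (σ s).u) t = _ := du
  replace f0 : deriv (fun s => (σ s).frame 1 0) t = _ := f0
  replace f1 : deriv (fun s => (σ s).frame 1 1) t = _ := f1
  replace f2 : deriv (fun s => (σ s).frame 1 2) t = _ := f2
  simp only [Pi.mul_apply, Pi.sub_apply, Pi.add_apply, Pi.neg_apply] at du f0 f1 f2
  generalize deriv (fun s => (σ s).p) t = p' at *
  generalize deriv (fun s => (σ s).q) t = q' at *
  generalize deriv (fun s => (σ s).p0) t = r' at *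
  generalize deriv (fun s => (σ s).q0) t = w' at *
  simp only [embeddingForms, mink, du, f0, f1, f2]
  generalize deriv (fun s => (σ s).v) t = v' at *
  generalize deriv (fun s => (σ s).x 0) t = x0' at *
  generalize deriv (fun s => (σ s).x 1) t = x1' at *
  generalize deriv (fun s => (σ s).x 2) t = x2' at *
  -- The four relations of V¹ express v' and the x' through the other velocities. After substitution
  -- the claims are rational identities with nonzero denominators.
  obtain rfl : v' = -(1 / 2 * (σ t).p0 ^ 2 * p' - 1 / 2 * (σ t).q0 ^ 2 * q') := by
    linear_combination h0
  clear h0 du f0 f1 f2 hV dp dq dp0 dq0 sp sq sp0 sq0 h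
  generalize σ t = n at *
  obtain ⟨p, q, r, w, x, v⟩ := n
  simp only [XSpace.u, XSpace.frame, Matrix.cons_val] at *
  obtain rfl : x0' = -(1 / 8 * r ^ 2 * (r ^ 2 * (p ^ 2 + 1) + w ^ 2 * (q ^ 2 - 2 * p * q - 1)) * p'
      - 1 / 4 * r * w ^ 2 * (p - q) * (p * q + 1) * r'
      - 1 / 8 * w ^ 2 * (r ^ 2 * (p ^ 2 - 2 * p * q - 1) + w ^ 2 * (q ^ 2 + 1)) * q'
      - 1 / 4 * r ^ 2 * w * (p - q) * (p * q + 1) * w') := by linear_combination h1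
  obtain rfl : x1' = -(1 / 8 * r ^ 2 * (r ^ 2 * (p ^ 2 - 1) + w ^ 2 * (q ^ 2 - 2 * p * q + 1)) * p'
      - 1 / 4 * r * w ^ 2 * (p - q) * (p * q - 1) * r'
      - 1 / 8 * w ^ 2 * (r ^ 2 * (p ^ 2 - 2 * p * q + 1) + w ^ 2 * (q ^ 2 - 1)) * q'
      - 1 / 4 * r ^ 2 * w * (p - q) * (p * q - 1) * w') := by linear_combination h2
  obtain rfl : x2' = -(-1 / 4 * p * r ^ 2 * (r ^ 2 - w ^ 2) * p'
      + 1 / 4 * r * w ^ 2 * (p ^ 2 - q ^ 2) * r' - 1 / 4 * q * w ^ 2 * (r ^ 2 - w ^ 2) * q'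
      + 1 / 4 * r ^ 2 * w * (p ^ 2 - q ^ 2) * w') := by linear_combination h3
  refine vec4_eq_zero ?_ ?_ ?_ ?_ <;> field_simp <;> ring

/-! ### The lift of a curve -/

theorem contDiffOn_vel {γ : ℝ → Mink} {J : Set ℝ} (hJ : IsOpen J) (hγ : ContDiffOn ℝ ∞ γ J)
    (i : Fin 3) : ContDiffOn ℝ ∞ (vel γ i) J :=
  ((contDiffOn_pi.1 hγ i).deriv_infty hJ)

theorem contDiffOn_velDiff {γ : ℝ → Mink} {J : Set ℝ} (hJ : IsOpen J) (hγ : ContDiffOn ℝ ∞ γ J) :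
    ContDiffOn ℝ ∞ (velDiff γ) J :=
  (contDiffOn_vel hJ hγ 0).sub (contDiffOn_vel hJ hγ 1)

theorem contDiffOn_velSq {γ : ℝ → Mink} {J : Set ℝ} (hJ : IsOpen J) (hγ : ContDiffOn ℝ ∞ γ J) :
    ContDiffOn ℝ ∞ (velSq γ) J :=
  (((contDiffOn_vel hJ hγ 0).pow 2).sub ((contDiffOn_vel hJ hγ 1).pow 2)).sub
    ((contDiffOn_vel hJ hγ 2).pow 2)

/-- The function `x̄₃' / (x̄₂' - x̄₁')`, the mean of `p` and `q` along the lift. -/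
noncomputable def meanPQ (γ : ℝ → Mink) (t : ℝ) : ℝ := vel γ 2 t / (vel γ 1 t - vel γ 0 t)

/-- The function `s = (x̄₁' - x̄₂') / (2 r³ r')`, half of `p - q` along the lift. -/
noncomputable def halfGap (γ : ℝ → Mink) (r : ℝ → ℝ) (t : ℝ) : ℝ :=
  velDiff γ t / (2 * r t ^ 3 * deriv r t)

/-- The lift of `γ` determined by the functions `r` and `v`. -/
noncomputable def radiusLift (γ : ℝ → Mink) (r v : ℝ → ℝ) (t : ℝ) : XSpace where
  p := meanPQ γ t + halfGap γ r t
  q := meanPQ γ t - halfGap γ r t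
  p0 := r t
  q0 := r t
  x := γ t
  v := v t

theorem contDiffOn_meanPQ {γ : ℝ → Mink} {J : Set ℝ} (hJ : IsOpen J) (hγ : ContDiffOn ℝ ∞ γ J)
    (hD : ∀ t ∈ J, velDiff γ t ≠ 0) : ContDiffOn ℝ ∞ (meanPQ γ) J :=
  (contDiffOn_vel hJ hγ 2).div ((contDiffOn_vel hJ hγ 1).sub (contDiffOn_vel hJ hγ 0))
    fun t ht h => hD t ht (by rw [velDiff]; linarith)

theorem contDiffOn_halfGap {γ : ℝ → Mink} {r : ℝ → ℝ} {J : Set ℝ} (hJ : IsOpen J)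
    (hγ : ContDiffOn ℝ ∞ γ J) (hr : ContDiffOn ℝ ∞ r J) (hr₀ : ∀ t ∈ J, r t ≠ 0 ∧ deriv r t ≠ 0) :
    ContDiffOn ℝ ∞ (halfGap γ r) J :=
  (contDiffOn_velDiff hJ hγ).div ((contDiffOn_const.mul (hr.pow 3)).mul (hr.deriv_infty hJ))
    fun t ht => by
      have := hr₀ t ht
      exact mul_ne_zero (mul_ne_zero two_ne_zero (pow_ne_zero _ this.1)) this.2

theorem velDiff_eq_halfGap {γ : ℝ → Mink} {r : ℝ → ℝ} {t : ℝ} (h : r t ≠ 0 ∧ deriv r t ≠ 0) :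
    velDiff γ t = 2 * r t ^ 3 * deriv r t * halfGap γ r t := by
  have := h.1
  have := h.2
  rw [halfGap]
  field_simp

theorem vel_two_eq_meanPQ {γ : ℝ → Mink} {t : ℝ} (h : velDiff γ t ≠ 0) :
    vel γ 2 t = -(meanPQ γ t * velDiff γ t) := by
  have h' : vel γ 1 t - vel γ 0 t ≠ 0 := fun h' => h (by rw [velDiff]; linarith)
  have := div_mul_cancel₀ (vel γ 2 t) h'
  rw [meanPQ, velDiff]
  linear_combination -this

/-- The second-order equation for `r`, expressed through `s`. -/
theorem velSq_eq_of_radiusODE {γ : ℝ → Mink} {r : ℝ → ℝ} {J : Set ℝ} (hJ : IsOpen J)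
    (hγ : ContDiffOn ℝ ∞ γ J) (hr : ContDiffOn ℝ ∞ r J) (hr₀ : ∀ t ∈ J, r t ≠ 0 ∧ deriv r t ≠ 0)
    (hode : RadiusODE γ J r) {t : ℝ} (ht : t ∈ J) :
    velSq γ t = -(velDiff γ t ^ 2 * halfGap γ r t ^ 2
      + 2 * velDiff γ t * r t ^ 4 * halfGap γ r t ^ 2 * deriv (halfGap γ r) t) := by
  obtain ⟨h0, h1⟩ := hr₀ t ht
  have dr := hr.hasDerivAt_of_isOpen hJ ht
  have drr := (hr.deriv_infty hJ).hasDerivAt_of_isOpen hJ ht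
  have ds := (contDiffOn_halfGap hJ hγ hr hr₀).hasDerivAt_of_isOpen hJ ht
  -- Differentiating D = 2r³r's brings r'' into D'. In the second-order equation this r'' cancels
  -- the one in D⁴rr'', leaving a relation with s' only.
  have hD : Set.EqOn (velDiff γ) (fun t => 2 * r t ^ 3 * deriv r t * halfGap γ r t) J :=
    fun t ht => velDiff_eq_halfGap (hr₀ t ht)
  have hD' := (deriv_eq_of_eqOn_isOpen hD hJ ht).trans
    ((((dr.pow 3).const_mul 2).mul drr).mul ds).deriv
  have h := hode t ht
  rw [hD', hD ht] at h
  rw [hD ht]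
  simp only [Pi.mul_apply, Pi.pow_apply] at h
  have hne : 4 * r t ^ 6 * deriv r t ^ 4 ≠ 0 := by positivity
  apply mul_left_cancel₀ hne
  norm_num at h
  linear_combination -h

/-- The definitions of s and m are the difference equation and the x₃-equation, and the hypothesis
on v is the dv-equation. Only the sum of the x₁- and x₂-equations uses the differential equation for
r. -/
theorem isIntegralCurveOne_radiusLift {γ : ℝ → Mink} {r v : ℝ → ℝ} {J : Set ℝ} {N : Set XSpace}
    (hJ : IsOpen J) (hγ : ContDiffOn ℝ ∞ γ J) (hD : ∀ t ∈ J, velDiff γ t ≠ 0)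
    (hr : ContDiffOn ℝ ∞ r J) (hr₀ : ∀ t ∈ J, r t ≠ 0 ∧ deriv r t ≠ 0) (hode : RadiusODE γ J r)
    (hv : ∀ t ∈ J, HasDerivAt v (-(r t ^ 2 * deriv (halfGap γ r) t)) t)
    (hN : ∀ t ∈ J, radiusLift γ r v t ∈ N) : IsIntegralCurveOne J N (radiusLift γ r v) := by
  have hm := contDiffOn_meanPQ hJ hγ hD
  have hs := contDiffOn_halfGap hJ hγ hr hr₀
  have hvs : ContDiffOn ℝ ∞ v J :=
    contDiffOn_infty_of_hasDerivAt hJ hv ((hr.pow 2).mul (hs.deriv_infty hJ)).neg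
  refine ⟨XSpace.contDiffOn_coords_iff.2 ⟨hm.add hs, hm.sub hs, hr, hr, contDiffOn_pi.1 hγ, hvs⟩,
    hN, fun t ht => ?_⟩
  have dm := hm.hasDerivAt_of_isOpen hJ ht
  have ds := hs.hasDerivAt_of_isOpen hJ ht
  have e1 : deriv (fun s => (radiusLift γ r v s).p) t = _ := (dm.add ds).deriv
  have e2 : deriv (fun s => (radiusLift γ r v s).q) t = _ := (dm.sub ds).deriv
  have e3 : deriv (fun s => (radiusLift γ r v s).v) t = _ := (hv t ht).deriv
  have hS := velSq_eq_of_radiusODE hJ hγ hr hr₀ hode ht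
  have hX := vel_two_eq_meanPQ (hD t ht)
  have hDg := velDiff_eq_halfGap (γ := γ) (hr₀ t ht)
  have h01 : vel γ 0 t - vel γ 1 t = velDiff γ t := rfl
  -- From (x̄₁' + x̄₂')D = `velSq` + x̄₃'², after division by D.
  have hsum : vel γ 0 t + vel γ 1 t = velDiff γ t * (meanPQ γ t ^ 2 - halfGap γ r t ^ 2)
      - 2 * r t ^ 4 * halfGap γ r t ^ 2 * deriv (halfGap γ r) t := by
    apply mul_left_cancel₀ (hD t ht)
    rw [velSq] at hS
    linear_combination hS - (vel γ 0 t + vel γ 1 t) * h01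
      + (vel γ 2 t - meanPQ γ t * velDiff γ t) * hX
  refine vec4_eq_zero ?_ ?_ ?_ ?_
  · simp only [XSpace.velocity, e1, e2, e3]
    simp only [radiusLift]
    ring
  · simp only [XSpace.velocity, e1, e2]
    simp only [radiusLift]
    change vel γ 0 t + _ - _ * deriv r t - _ - _ * deriv r t = 0
    linear_combination (1 / 2) * (h01 + hsum)
      + (1 / 2) * (1 + meanPQ γ t ^ 2 - halfGap γ r t ^ 2) * hDg
  · simp only [XSpace.velocity, e1, e2]
    simp only [radiusLift]
    change vel γ 1 t + _ - _ * deriv r t - _ - _ * deriv r t = 0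
    linear_combination (1 / 2) * (hsum - h01)
      + (1 / 2) * (-1 + meanPQ γ t ^ 2 - halfGap γ r t ^ 2) * hDg
  · simp only [XSpace.velocity, e1, e2]
    simp only [radiusLift]
    change vel γ 2 t - _ + _ * deriv r t - _ + _ * deriv r t = 0
    linear_combination hX - meanPQ γ t * hDg

/-- The lift is non-characteristic because V¹₊ contains dq₀ and V¹₋ contains dp₀, while r' has no
zeros. The first two components of e₃ differ by a multiple of p₀² - q₀² = 0. -/
theorem isLift_radiusLift {γ : ℝ → Mink} {r v : ℝ → ℝ} {J : Set ℝ} {N : Set XSpace}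
    (hJ : IsOpen J) (hγ : ContDiffOn ℝ ∞ γ J) (hD : ∀ t ∈ J, velDiff γ t ≠ 0)
    (hr : ContDiffOn ℝ ∞ r J) (hr₀ : ∀ t ∈ J, r t ≠ 0 ∧ deriv r t ≠ 0) (hode : RadiusODE γ J r)
    (hv : ∀ t ∈ J, HasDerivAt v (-(r t ^ 2 * deriv (halfGap γ r) t)) t)
    (hN : ∀ t ∈ J, radiusLift γ r v t ∈ N) (hNF : N ⊆ NFull) :
    IsLift γ J N (radiusLift γ r v) r := by
  have hσ := isIntegralCurveOne_radiusLift hJ hγ hD hr hr₀ hode hv hN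
  refine ⟨fun _ _ => rfl, hσ, fun t ht => ⟨fun h => ?_, fun h => ?_⟩,
    hσ.isEmbeddingIntegralCurve hJ hNF, fun t ht => ?_,
    ⟨hode, hr₀, fun _ _ => rfl, fun _ _ => rfl, fun _ _ => rfl, fun _ _ => rfl⟩⟩
  · exact (hr₀ t ht).2 (congrFun h 1)
  · exact (hr₀ t ht).2 (congrFun h 1)
  · simp only [XSpace.frame, Matrix.cons_val, radiusLift]
    congr 1
    ring

/-! ### Decomposition into characteristic curves -/

theorem CauchyEmbedding.IsIntegralPlus.contDiffOn {J : Set ℝ} {σ : ℝ → HatPlus}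
    (h : IsIntegralPlus J σ) :
    ContDiffOn ℝ ∞ (fun t => (σ t).p) J ∧ ContDiffOn ℝ ∞ (fun t => (σ t).p0) J ∧
      ContDiffOn ℝ ∞ (fun t => (σ t).v) J ∧ ∀ i, ContDiffOn ℝ ∞ (fun t => (σ t).y i) J :=
  ⟨h.smooth.fst, h.smooth.snd.fst, h.smooth.snd.snd.fst, contDiffOn_pi.1 h.smooth.snd.snd.snd⟩

theorem CauchyEmbedding.IsIntegralMinus.contDiffOn {J : Set ℝ} {σ : ℝ → HatMinus}
    (h : IsIntegralMinus J σ) :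
    ContDiffOn ℝ ∞ (fun t => (σ t).q) J ∧ ContDiffOn ℝ ∞ (fun t => (σ t).q0) J ∧
      ContDiffOn ℝ ∞ (fun t => (σ t).v) J ∧ ∀ i, ContDiffOn ℝ ∞ (fun t => (σ t).y i) J :=
  ⟨h.smooth.fst, h.smooth.snd.fst, h.smooth.snd.snd.fst, contDiffOn_pi.1 h.smooth.snd.snd.snd⟩

/-- The derivatives of `v⁺, y⁺` along a characteristic curve with coordinates `p, p₀`, where `p'`
is the derivative of `p`. -/
noncomputable def plusRate (p p0 p' : ℝ) : Fin 4 → ℝ :=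
  ![-(1 / 2 * p0 ^ 2 * p'), -(1 / 8 * p0 ^ 4 * (p ^ 2 + 1) * p'),
    -(1 / 8 * p0 ^ 4 * (p ^ 2 - 1) * p'), 1 / 4 * p * p0 ^ 4 * p']

theorem contDiffOn_plusRate {p p0 p' : ℝ → ℝ} {J : Set ℝ} (hp : ContDiffOn ℝ ∞ p J)
    (hp0 : ContDiffOn ℝ ∞ p0 J) (hp' : ContDiffOn ℝ ∞ p' J) (i : Fin 4) :
    ContDiffOn ℝ ∞ (fun t => plusRate (p t) (p0 t) (p' t) i) J := by
  fin_cases i <;> simp only [plusRate] <;> simp <;> fun_prop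

theorem CauchyEmbedding.IsIntegralPlus.hasDerivAt {J : Set ℝ} (hJ : IsOpen J) {σ : ℝ → HatPlus}
    (h : IsIntegralPlus J σ) {t : ℝ} (ht : t ∈ J) :
    HasDerivAt (fun t => (σ t).v)
      (plusRate (σ t).p (σ t).p0 (deriv (fun s => (σ s).p) t) 0) t ∧
    ∀ i : Fin 3, HasDerivAt (fun t => (σ t).y i)
      (plusRate (σ t).p (σ t).p0 (deriv (fun s => (σ s).p) t) i.succ) t := by
  obtain ⟨-, -, sv, sy⟩ := h.contDiffOn
  have hv := h.v_eq t ht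
  have h0 := h.y0_eq t ht
  have h1 := h.y1_eq t ht
  have h2 := h.y2_eq t ht
  refine ⟨?_, fun i => ?_⟩
  · refine (sv.hasDerivAt_of_isOpen hJ ht).congr_deriv ?_
    simp only [plusRate, Matrix.cons_val]
    linear_combination hv
  · refine (sy i).hasDerivAt_of_isOpen hJ ht |>.congr_deriv ?_
    fin_cases i <;> simp [plusRate]
    · linear_combination h0
    · linear_combination h1
    · linear_combination h2

/-- The dq-parts of the 1-forms are the dp-parts with opposite sign and q, q₀ in place of p, p₀, so
`plusRate` serves both families. -/
theorem CauchyEmbedding.IsIntegralMinus.hasDerivAt {J : Set ℝ} (hJ : IsOpen J) {σ : ℝ → HatMinus}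
    (h : IsIntegralMinus J σ) {t : ℝ} (ht : t ∈ J) :
    HasDerivAt (fun t => (σ t).v)
      (-plusRate (σ t).q (σ t).q0 (deriv (fun s => (σ s).q) t) 0) t ∧
    ∀ i : Fin 3, HasDerivAt (fun t => (σ t).y i)
      (-plusRate (σ t).q (σ t).q0 (deriv (fun s => (σ s).q) t) i.succ) t := by
  obtain ⟨-, -, sv, sy⟩ := h.contDiffOn
  have hv := h.v_eq t ht
  have h0 := h.y0_eq t ht
  have h1 := h.y1_eq t ht
  have h2 := h.y2_eq t ht
  refine ⟨?_, fun i => ?_⟩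
  · refine (sv.hasDerivAt_of_isOpen hJ ht).congr_deriv ?_
    simp only [plusRate, Matrix.cons_val]
    linear_combination hv
  · refine (sy i).hasDerivAt_of_isOpen hJ ht |>.congr_deriv ?_
    fin_cases i <;> simp [plusRate]
    · linear_combination h0
    · linear_combination h1
    · linear_combination h2

theorem contDiffOn_coords_psi {J : Set ℝ} {σ : ℝ → XSpace}
    (h : ContDiffOn ℝ ∞ (fun t => (σ t).coords) J) :
    ContDiffOn ℝ ∞ (fun t => (psi (σ t)).coords) J := by
  obtain ⟨sp, sq, sp0, sq0, sx, sv⟩ := XSpace.contDiffOn_coords_iff.1 h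
  have := sx 0
  have := sx 1
  have := sx 2
  refine YSpace.contDiffOn_coords_iff.2 ⟨sp, sq, sp0, sq0, fun i => ?_, sv⟩
  fin_cases i <;> simp [psi] <;> fun_prop

/-- `ψ` maps integral curves of `V¹` to integral curves of `V²`. -/
theorem CauchyEmbedding.IsIntegralCurveOne.VTwo_psi {J : Set ℝ} (hJ : IsOpen J)
    {N : Set XSpace} {σ : ℝ → XSpace} (h : IsIntegralCurveOne J N σ) {t : ℝ} (ht : t ∈ J) :
    VTwo (psi (σ t)) (YSpace.velocity (fun t => psi (σ t)) t) = 0 := by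
  obtain ⟨sp, sq, sp0, sq0, sx, -⟩ := XSpace.contDiffOn_coords_iff.1 h.smooth
  have dp := sp.hasDerivAt_of_isOpen hJ ht
  have dq := sq.hasDerivAt_of_isOpen hJ ht
  have dp0 := sp0.hasDerivAt_of_isOpen hJ ht
  have dq0 := sq0.hasDerivAt_of_isOpen hJ ht
  have dx := fun i => (sx i).hasDerivAt_of_isOpen hJ ht
  have hV := h.integral t ht
  have h0 := congrFun hV 0
  have h1 := congrFun hV 1
  have h2 := congrFun hV 2
  have h3 := congrFun hV 3
  simp only [VOne, XSpace.velocity, Matrix.cons_val, Pi.zero_apply] at h0 h1 h2 h3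
  -- The differential of each correction term in ψ is the sum of all terms of the corresponding form
  -- of V¹ in which both p₀ and q₀ occur; only pure terms survive.
  have y0 : deriv (fun s => (psi (σ s)).y 0) t = _ :=
    ((dx 0).sub (((((dp0.pow 2).const_mul (1 / 8 : ℝ)).mul (dq0.pow 2)).mul (dp.sub dq)).mul
      ((dp.mul dq).const_add 1))).deriv
  have y1 : deriv (fun s => (psi (σ s)).y 1) t = _ :=
    ((dx 1).add (((((dp0.pow 2).const_mul (1 / 8 : ℝ)).mul (dq0.pow 2)).mul (dp.sub dq)).mul
      ((dp.mul dq).const_sub 1))).deriv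
  have y2 : deriv (fun s => (psi (σ s)).y 2) t = _ :=
    ((dx 2).add ((((dp0.pow 2).const_mul (1 / 8 : ℝ)).mul (dq0.pow 2)).mul
      ((dp.pow 2).sub (dq.pow 2)))).deriv
  simp only [Pi.mul_apply, Pi.sub_apply, Pi.pow_apply] at y0 y1 y2
  refine vec4_eq_zero h0 ?_ ?_ ?_ <;> simp only [YSpace.velocity, y0, y1, y2] <;>
    simp only [psi]
  · norm_num
    linear_combination h1
  · norm_num
    linear_combination h2
  · norm_num
    linear_combination h3

/-- The components v⁺, y⁺ are antiderivatives of the dp-parts along σ. Subtracting them from v, y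
leaves functions that satisfy the dq-parts, because σ satisfies the sums. -/
theorem exists_isDecomposition {α β : ℝ} {N : Set XSpace} {σ : ℝ → XSpace}
    (h : IsIntegralCurveOne (Set.Ioo α β) N σ) :
    ∃ σp σm, IsDecomposition (Set.Ioo α β) (fun t => psi (σ t)) σp σm := by
  obtain ⟨sp, sq, sp0, sq0, sy, sv⟩ :=
    YSpace.contDiffOn_coords_iff.1 (contDiffOn_coords_psi h.smooth)
  have srate := contDiffOn_plusRate sp sp0 (sp.deriv_infty isOpen_Ioo)
  choose F hF using fun i => exists_antiderivative (srate i).continuousOn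
  have sF : ∀ i, ContDiffOn ℝ ∞ (F i) (Set.Ioo α β) := fun i =>
    contDiffOn_infty_of_hasDerivAt isOpen_Ioo (hF i) (srate i)
  have dY : ∀ t ∈ Set.Ioo α β, ∀ i : Fin 3,
      deriv (fun t => (psi (σ t)).y i - F i.succ t) t =
        deriv (fun t => (psi (σ t)).y i) t - plusRate (psi (σ t)).p (psi (σ t)).p0
          (deriv (fun s => (psi (σ s)).p) t) i.succ := fun t ht i =>
    (((sy i).hasDerivAt_of_isOpen isOpen_Ioo ht).sub (hF i.succ t ht)).deriv
  have dV : ∀ t ∈ Set.Ioo α β, deriv (fun t => (psi (σ t)).v - F 0 t) t =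
        deriv (fun t => (psi (σ t)).v) t - plusRate (psi (σ t)).p (psi (σ t)).p0
          (deriv (fun s => (psi (σ s)).p) t) 0 := fun t ht =>
    ((sv.hasDerivAt_of_isOpen isOpen_Ioo ht).sub (hF 0 t ht)).deriv
  refine ⟨fun t => ⟨(psi (σ t)).p, (psi (σ t)).p0, F 0 t, fun i => F i.succ t⟩,
    fun t => ⟨(psi (σ t)).q, (psi (σ t)).q0, (psi (σ t)).v - F 0 t,
      fun i => (psi (σ t)).y i - F i.succ t⟩, ⟨?_, ?_, ?_, ?_, ?_⟩, ⟨?_, ?_, ?_, ?_, ?_⟩, ?_⟩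
  · exact sp.prodMk (sp0.prodMk ((sF 0).prodMk (contDiffOn_pi.2 fun i => sF i.succ)))
  · intro t ht
    rw [(hF 0 t ht).deriv]
    simp [plusRate]
  · intro t ht
    rw [(hF _ t ht).deriv]
    simp [plusRate]
  · intro t ht
    rw [(hF _ t ht).deriv]
    simp [plusRate]
  · intro t ht
    rw [(hF _ t ht).deriv]
    simp [plusRate]
  · exact sq.prodMk (sq0.prodMk ((sv.sub (sF 0)).prodMk
      (contDiffOn_pi.2 fun i => (sy i).sub (sF i.succ))))
  · intro t ht
    have := congrFun (h.VTwo_psi isOpen_Ioo ht) 0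
    simp only [VTwo, YSpace.velocity, Matrix.cons_val, Pi.zero_apply] at this
    rw [dV t ht]
    simp [plusRate]
    linear_combination this
  · intro t ht
    have := congrFun (h.VTwo_psi isOpen_Ioo ht) 1
    simp only [VTwo, YSpace.velocity, Matrix.cons_val, Pi.zero_apply] at this
    rw [dY t ht]
    simp [plusRate]
    linear_combination this
  · intro t ht
    have := congrFun (h.VTwo_psi isOpen_Ioo ht) 2
    simp only [VTwo, YSpace.velocity, Matrix.cons_val, Pi.zero_apply] at this
    rw [dY t ht]
    simp [plusRate]
    linear_combination this
  · intro t ht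
    have := congrFun (h.VTwo_psi isOpen_Ioo ht) 3
    simp only [VTwo, YSpace.velocity, Matrix.cons_val, Pi.zero_apply] at this
    rw [dY t ht]
    simp [plusRate]
    linear_combination this
  · intro t _
    ext <;> simp [superpose]

theorem CauchyEmbedding.IsDecomposition.plus_eqOn {J : Set ℝ} {σ : ℝ → YSpace} {σp : ℝ → HatPlus}
    {σm : ℝ → HatMinus} (h : IsDecomposition J σ σp σm) :
    Set.EqOn (fun t => (σp t).p) (fun t => (σ t).p) J ∧
      Set.EqOn (fun t => (σp t).p0) (fun t => (σ t).p0) J :=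
  ⟨fun t ht => congrArg YSpace.p (h.eq t ht).symm, fun t ht => congrArg YSpace.p0 (h.eq t ht).symm⟩

theorem CauchyEmbedding.IsDecomposition.minus_eqOn {J : Set ℝ} {σ : ℝ → YSpace} {σp : ℝ → HatPlus}
    {σm : ℝ → HatMinus} (h : IsDecomposition J σ σp σm) :
    Set.EqOn (fun t => (σm t).q) (fun t => (σ t).q) J ∧
      Set.EqOn (fun t => (σm t).q0) (fun t => (σ t).q0) J :=
  ⟨fun t ht => congrArg YSpace.q (h.eq t ht).symm, fun t ht => congrArg YSpace.q0 (h.eq t ht).symm⟩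

/-- The components of a characteristic curve in a decomposition of `σ` are antiderivatives of
functions determined by `σ`. -/
theorem CauchyEmbedding.IsDecomposition.hasDerivAt_plus {J : Set ℝ} (hJ : IsOpen J)
    {σ : ℝ → YSpace} {σp : ℝ → HatPlus} {σm : ℝ → HatMinus} (h : IsDecomposition J σ σp σm) {t : ℝ}
    (ht : t ∈ J) :
    HasDerivAt (fun t => (σp t).v) (plusRate (σ t).p (σ t).p0 (deriv (fun s => (σ s).p) t) 0) t ∧
    ∀ i : Fin 3, HasDerivAt (fun t => (σp t).y i)
      (plusRate (σ t).p (σ t).p0 (deriv (fun s => (σ s).p) t) i.succ) t := by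
  have := h.plus.hasDerivAt hJ ht
  rwa [deriv_eq_of_eqOn_isOpen h.plus_eqOn.1 hJ ht, show (σp t).p = _ from h.plus_eqOn.1 ht,
    show (σp t).p0 = _ from h.plus_eqOn.2 ht] at this

theorem CauchyEmbedding.IsDecomposition.hasDerivAt_minus {J : Set ℝ} (hJ : IsOpen J)
    {σ : ℝ → YSpace} {σp : ℝ → HatPlus} {σm : ℝ → HatMinus} (h : IsDecomposition J σ σp σm) {t : ℝ}
    (ht : t ∈ J) :
    HasDerivAt (fun t => (σm t).v) (-plusRate (σ t).q (σ t).q0 (deriv (fun s => (σ s).q) t) 0) t ∧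
    ∀ i : Fin 3, HasDerivAt (fun t => (σm t).y i)
      (-plusRate (σ t).q (σ t).q0 (deriv (fun s => (σ s).q) t) i.succ) t := by
  have := h.minus.hasDerivAt hJ ht
  rwa [deriv_eq_of_eqOn_isOpen h.minus_eqOn.1 hJ ht, show (σm t).q = _ from h.minus_eqOn.1 ht,
    show (σm t).q0 = _ from h.minus_eqOn.2 ht] at this

/-- The derivatives of v⁺, y⁺ are determined by σ, so two choices differ by constants; since the
sums with v⁻, y⁻ are fixed, the opposite constants appear there. -/
theorem CauchyEmbedding.IsDecomposition.unique {α β : ℝ} {σ : ℝ → YSpace}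
    {σp τp : ℝ → HatPlus} {σm τm : ℝ → HatMinus} (hσ : IsDecomposition (Set.Ioo α β) σ σp σm)
    (hτ : IsDecomposition (Set.Ioo α β) σ τp τm) :
    ∃ (c : ℝ) (k : Mink), ∀ t ∈ Set.Ioo α β,
      τp t = ⟨(σp t).p, (σp t).p0, (σp t).v + c, (σp t).y + k⟩ ∧
      τm t = ⟨(σm t).q, (σm t).q0, (σm t).v - c, (σm t).y - k⟩ := by
  obtain ⟨c, hc⟩ := exists_eq_add_const_of_hasDerivAt
    (fun t ht => (hσ.hasDerivAt_plus isOpen_Ioo ht).1)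
    (fun t ht => (hτ.hasDerivAt_plus isOpen_Ioo ht).1)
  choose k hk using fun i => exists_eq_add_const_of_hasDerivAt
    (fun t ht => (hσ.hasDerivAt_plus isOpen_Ioo ht).2 i)
    (fun t ht => (hτ.hasDerivAt_plus isOpen_Ioo ht).2 i)
  refine ⟨c, k, fun t ht => ⟨?_, ?_⟩⟩
  · ext i
    · exact (hτ.plus_eqOn.1 ht).trans (hσ.plus_eqOn.1 ht).symm
    · exact (hτ.plus_eqOn.2 ht).trans (hσ.plus_eqOn.2 ht).symm
    · exact hc t ht
    · exact hk i t ht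
  · have e := (hτ.eq t ht).symm.trans (hσ.eq t ht)
    ext i
    · exact (hτ.minus_eqOn.1 ht).trans (hσ.minus_eqOn.1 ht).symm
    · exact (hτ.minus_eqOn.2 ht).trans (hσ.minus_eqOn.2 ht).symm
    · have : (τp t).v + (τm t).v = (σp t).v + (σm t).v := congrArg YSpace.v e
      have := hc t ht
      simp only
      linarith
    · have : (τp t).y i + (τm t).y i = (σp t).y i + (σm t).y i := congrFun (congrArg YSpace.y e) i
      have := hk i t ht
      simp only [Pi.sub_apply]
      linarith

theorem CauchyEmbedding.IsDecomposition.superpose_eq {α β : ℝ} {σ : ℝ → YSpace}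
    {σp τp : ℝ → HatPlus} {σm τm : ℝ → HatMinus} (hσ : IsDecomposition (Set.Ioo α β) σ σp σm)
    (hτ : IsDecomposition (Set.Ioo α β) σ τp τm) {t₁ t₂ : ℝ} (h₁ : t₁ ∈ Set.Ioo α β)
    (h₂ : t₂ ∈ Set.Ioo α β) : superpose (σp t₁) (σm t₂) = superpose (τp t₁) (τm t₂) := by
  obtain ⟨c, k, h⟩ := hσ.unique hτ
  rw [(h t₁ h₁).1, (h t₂ h₂).2]
  ext <;> simp [superpose]

theorem contDiffOn_coords_superpose {J : Set ℝ} {σp : ℝ → HatPlus} {σm : ℝ → HatMinus}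
    (hp : IsIntegralPlus J σp) (hm : IsIntegralMinus J σm) :
    ContDiffOn ℝ ∞ (fun t : ℝ × ℝ => (superpose (σp t.1) (σm t.2)).coords) (J ×ˢ J) := by
  obtain ⟨sp, sp0, sv, sy⟩ := hp.contDiffOn
  obtain ⟨sq, sq0, sw, sz⟩ := hm.contDiffOn
  have hf : Set.MapsTo Prod.fst (J ×ˢ J) J := fun x hx => hx.1
  have hs : Set.MapsTo Prod.snd (J ×ˢ J) J := fun x hx => hx.2
  exact YSpace.contDiffOn_coords_iff.2 ⟨sp.comp contDiffOn_fst hf, sq.comp contDiffOn_snd hs,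
    sp0.comp contDiffOn_fst hf, sq0.comp contDiffOn_snd hs,
    fun i => ((sy i).comp contDiffOn_fst hf).add ((sz i).comp contDiffOn_snd hs),
    (sv.comp contDiffOn_fst hf).add (sw.comp contDiffOn_snd hs)⟩

/-- Since p, p₀ depend on t₁ alone and q, q₀ on t₂ alone, both 2-forms vanish and each partial
velocity meets only one half of each 1-form. Independence of the velocities is visible in the (p₀,
q₀)-components. Membership is assumed for all y, v because the superposed values off the diagonal
are not those of σ. -/
theorem isIntegralSurface_superpose {J : Set ℝ} (hJ : IsOpen J) {N : Set YSpace} {σ : ℝ → YSpace}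
    {σp : ℝ → HatPlus} {σm : ℝ → HatMinus} (h : IsDecomposition J σ σp σm)
    (hN : ∀ t₁ ∈ J, ∀ t₂ ∈ J, ∀ y v,
      (⟨(σ t₁).p, (σ t₂).q, (σ t₁).p0, (σ t₂).q0, y, v⟩ : YSpace) ∈ N)
    (hp0 : ∀ t ∈ J, deriv (fun t => (σ t).p0) t ≠ 0)
    (hq0 : ∀ t ∈ J, deriv (fun t => (σ t).q0) t ≠ 0) :
    IsIntegralSurface J N (fun t₁ t₂ => superpose (σp t₁) (σm t₂)) where
  smooth := contDiffOn_coords_superpose h.plus h.minus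
  mem t₁ h₁ t₂ h₂ := by
    have := hN t₁ h₁ t₂ h₂ ((σp t₁).y + (σm t₂).y) ((σp t₁).v + (σm t₂).v)
    rwa [h.eq t₁ h₁, h.eq t₂ h₂] at this
  oneForms₁ t₁ h₁ t₂ h₂ := by
    refine vec4_eq_zero ?_ ?_ ?_ ?_ <;> simp only [YSpace.velocity, superpose] <;>
      simp only [Pi.add_apply, deriv_add_const, deriv_const]
    · linear_combination h.plus.v_eq t₁ h₁
    · linear_combination h.plus.y0_eq t₁ h₁
    · linear_combination h.plus.y1_eq t₁ h₁
    · linear_combination h.plus.y2_eq t₁ h₁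
  oneForms₂ t₁ h₁ t₂ h₂ := by
    refine vec4_eq_zero ?_ ?_ ?_ ?_ <;> simp only [YSpace.velocity, superpose] <;>
      simp only [Pi.add_apply, deriv_const_add, deriv_const]
    · linear_combination h.minus.v_eq t₂ h₂
    · linear_combination h.minus.y0_eq t₂ h₂
    · linear_combination h.minus.y1_eq t₂ h₂
    · linear_combination h.minus.y2_eq t₂ h₂
  twoForms t₁ _ t₂ _ := by
    ext i
    fin_cases i <;> simp [twoForms, YSpace.velocity, superpose]
  immersion t₁ h₁ t₂ h₂ := by
    have e1 := hp0 t₁ h₁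
    have e2 := hq0 t₂ h₂
    rw [← deriv_eq_of_eqOn_isOpen h.plus_eqOn.2 hJ h₁] at e1
    rw [← deriv_eq_of_eqOn_isOpen h.minus_eqOn.2 hJ h₂] at e2
    rw [LinearIndependent.pair_iff]
    intro c d hcd
    have h2 := congrFun hcd 2
    have h3 := congrFun hcd 3
    simp [YSpace.velocity, superpose, YSpace.coords] at h2 h3
    exact ⟨h2.resolve_right e1, h3.resolve_right e2⟩

theorem hasUniqueDecomposition_psi {α β : ℝ} {N : Set XSpace} {σ : ℝ → XSpace}
    (h : IsIntegralCurveOne (Set.Ioo α β) N σ)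
    (hN : ∀ t₁ ∈ Set.Ioo α β, ∀ t₂ ∈ Set.Ioo α β, ∀ x v,
      (⟨(σ t₁).p, (σ t₂).q, (σ t₁).p0, (σ t₂).q0, x, v⟩ : XSpace) ∈ N)
    (hp0 : ∀ t ∈ Set.Ioo α β, deriv (fun t => (σ t).p0) t ≠ 0)
    (hq0 : ∀ t ∈ Set.Ioo α β, deriv (fun t => (σ t).q0) t ≠ 0) :
    HasUniqueDecomposition (Set.Ioo α β) (psi '' N) (fun t => psi (σ t)) where
  exist := exists_isDecomposition h
  surface _ _ hd := isIntegralSurface_superpose isOpen_Ioo hd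
    (fun t₁ h₁ t₂ h₂ _ _ => mem_psi_image_iff.2 (hN t₁ h₁ t₂ h₂ _ _)) hp0 hq0
  unique_up_to_constants _ _ _ _ hσ hτ := hσ.unique hτ
  surface_unique _ _ _ _ hσ hτ _ h₁ _ h₂ := hσ.superpose_eq hτ h₁ h₂

/-! ### The surface in `ℝ^{1,2}` -/

theorem contDiffOn_coords_psiInv {E : Type*} [NormedAddCommGroup E] [NormedSpace ℝ E] {O : Set E}
    {S : E → YSpace} (h : ContDiffOn ℝ ∞ (fun t => (S t).coords) O) :
    ContDiffOn ℝ ∞ (fun t => (psiInv (S t)).coords) O := by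
  obtain ⟨sp, sq, sp0, sq0, sy, sv⟩ := YSpace.contDiffOn_coords_iff.1 h
  have := sy 0
  have := sy 1
  have := sy 2
  refine XSpace.contDiffOn_coords_iff.2 ⟨sp, sq, sp0, sq0, fun i => ?_, sv⟩
  fin_cases i <;> simp [psiInv] <;> fun_prop

/-- The partial derivatives of `(u, v)` in the direction of the first characteristic
curve; `p', r'` are the derivatives of `p, p₀`. -/
noncomputable def plusUV (p q r w p' r' : ℝ) : ℝ × ℝ :=
  (-(1 / 2) * (r' * w * (p - q) + r * w * p'), -(1 / 2 * r ^ 2 * p'))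

/-- The partial derivatives of `x` in the direction of the first characteristic curve. -/
noncomputable def plusX (p q r w p' r' : ℝ) : Mink :=
  ![-(1 / 8 * r ^ 4 * (p ^ 2 + 1) * p') + 1 / 8 * (2 * r * r' * w ^ 2 * (p - q) * (1 + p * q)
      + r ^ 2 * w ^ 2 * (p' * (1 + p * q) + (p - q) * (p' * q))),
    -(1 / 8 * r ^ 4 * (p ^ 2 - 1) * p') - 1 / 8 * (2 * r * r' * w ^ 2 * (p - q) * (1 - p * q)
      + r ^ 2 * w ^ 2 * (p' * (1 - p * q) - (p - q) * (p' * q))),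
    1 / 4 * p * r ^ 4 * p' - 1 / 8 * (2 * r * r' * w ^ 2 * (p ^ 2 - q ^ 2)
      + r ^ 2 * w ^ 2 * (2 * p * p'))]

/-- The partial derivatives of `(u, v)` in the direction of the second characteristic
curve; `q', w'` are the derivatives of `q, q₀`. -/
noncomputable def minusUV (p q r w q' w' : ℝ) : ℝ × ℝ :=
  (-(1 / 2) * (r * w' * (p - q) - r * w * q'), 1 / 2 * w ^ 2 * q')

/-- The partial derivatives of `x` in the direction of the second characteristic curve. -/
noncomputable def minusX (p q r w q' w' : ℝ) : Mink :=
  ![1 / 8 * w ^ 4 * (q ^ 2 + 1) * q' + 1 / 8 * (2 * w * w' * r ^ 2 * (p - q) * (1 + p * q)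
      + r ^ 2 * w ^ 2 * (-q' * (1 + p * q) + (p - q) * (p * q'))),
    1 / 8 * w ^ 4 * (q ^ 2 - 1) * q' - 1 / 8 * (2 * w * w' * r ^ 2 * (p - q) * (1 - p * q)
      + r ^ 2 * w ^ 2 * (-q' * (1 - p * q) - (p - q) * (p * q'))),
    -(1 / 4 * q * w ^ 4 * q') - 1 / 8 * (2 * w * w' * r ^ 2 * (p ^ 2 - q ^ 2)
      - r ^ 2 * w ^ 2 * (2 * q * q'))]

/-- Both sides are symmetric and bilinear, so three products of partial derivatives suffice. These
are polynomial identities in p, q, p₀, q₀ and arbitrary velocities; v is free because the metric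
does not depend on it. -/
theorem mink_eq_gZero_of_partials (p q r w p' r' q' w' v : ℝ) (a b : ℝ × ℝ) :
    mink (a.1 • plusX p q r w p' r' + a.2 • minusX p q r w q' w')
      (b.1 • plusX p q r w p' r' + b.2 • minusX p q r w q' w') =
    gZero (-(1 / 2) * r * w * (p - q), v)
      (a.1 • plusUV p q r w p' r' + a.2 • minusUV p q r w q' w')
      (b.1 • plusUV p q r w p' r' + b.2 • minusUV p q r w q' w') := by
  have h11 : mink (plusX p q r w p' r') (plusX p q r w p' r') =
      gZero (-(1 / 2) * r * w * (p - q), v) (plusUV p q r w p' r') (plusUV p q r w p' r') := by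
    simp only [mink, gZero, plusX, plusUV, Matrix.cons_val]
    ring
  have h12 : mink (plusX p q r w p' r') (minusX p q r w q' w') =
      gZero (-(1 / 2) * r * w * (p - q), v) (plusUV p q r w p' r') (minusUV p q r w q' w') := by
    simp only [mink, gZero, plusX, plusUV, minusX, minusUV, Matrix.cons_val]
    ring
  have h22 : mink (minusX p q r w q' w') (minusX p q r w q' w') =
      gZero (-(1 / 2) * r * w * (p - q), v) (minusUV p q r w q' w') (minusUV p q r w q' w') := by
    simp only [mink, gZero, minusX, minusUV, Matrix.cons_val]
    ring
  generalize plusX p q r w p' r' = X at *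
  generalize minusX p q r w q' w' = Y at *
  generalize plusUV p q r w p' r' = A at *
  generalize minusUV p q r w q' w' = B at *
  simp only [mink, gZero, Pi.add_apply, Pi.smul_apply, Prod.fst_add, Prod.snd_add, Prod.smul_fst,
    Prod.smul_snd, smul_eq_mul] at *
  linear_combination a.1 * b.1 * h11 + (a.1 * b.2 + a.2 * b.1) * h12 + a.2 * b.2 * h22

section Surface

variable {J : Set ℝ} {σ : ℝ → YSpace} {σp : ℝ → HatPlus} {σm : ℝ → HatMinus}

/-- The point of `N` over the parameters `t` of the surface defined by a decomposition. -/
noncomputable def surfacePoint (σp : ℝ → HatPlus) (σm : ℝ → HatMinus) (t : ℝ × ℝ) : XSpace :=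
  psiInv (superpose (σp t.1) (σm t.2))

theorem contDiffOn_coords_surfacePoint (h : IsDecomposition J σ σp σm) :
    ContDiffOn ℝ ∞ (fun t => (surfacePoint σp σm t).coords) (J ×ˢ J) :=
  contDiffOn_coords_psiInv (contDiffOn_coords_superpose h.plus h.minus)

theorem contDiffOn_surfacePoint_uv (h : IsDecomposition J σ σp σm) :
    ContDiffOn ℝ ∞ (fun t => ((surfacePoint σp σm t).u, (surfacePoint σp σm t).v)) (J ×ˢ J) := by
  obtain ⟨sp, sq, sp0, sq0, -, sv⟩ :=
    XSpace.contDiffOn_coords_iff.1 (contDiffOn_coords_surfacePoint h)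
  exact ContDiffOn.prodMk (((contDiffOn_const.mul sp0).mul sq0).mul (sp.sub sq)) sv

theorem contDiffOn_surfacePoint_x (h : IsDecomposition J σ σp σm) :
    ContDiffOn ℝ ∞ (fun t => (surfacePoint σp σm t).x) (J ×ˢ J) :=
  contDiffOn_pi.2 (XSpace.contDiffOn_coords_iff.1 (contDiffOn_coords_surfacePoint h)).2.2.2.2.1

theorem surfacePoint_u (h : IsDecomposition J σ σp σm) {t : ℝ × ℝ} (ht : t ∈ J ×ˢ J) :
    (surfacePoint σp σm t).u =
      -(1 / 2) * (σ t.1).p0 * (σ t.2).q0 * ((σ t.1).p - (σ t.2).q) := by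
  rw [h.eq _ ht.1, h.eq _ ht.2]
  rfl

theorem hasDerivAt_surfacePoint_plus (hJ : IsOpen J) (h : IsDecomposition J σ σp σm) {t : ℝ × ℝ}
    (ht : t ∈ J ×ˢ J) :
    HasDerivAt (fun a => ((surfacePoint σp σm (a, t.2)).u, (surfacePoint σp σm (a, t.2)).v))
      (plusUV (σ t.1).p (σ t.2).q (σ t.1).p0 (σ t.2).q0 (deriv (fun s => (σ s).p) t.1)
        (deriv (fun s => (σ s).p0) t.1)) t.1 ∧
    HasDerivAt (fun a => (surfacePoint σp σm (a, t.2)).x)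
      (plusX (σ t.1).p (σ t.2).q (σ t.1).p0 (σ t.2).q0 (deriv (fun s => (σ s).p) t.1)
        (deriv (fun s => (σ s).p0) t.1)) t.1 := by
  obtain ⟨sp, sp0, -, -⟩ := h.plus.contDiffOn
  have dp := sp.hasDerivAt_of_isOpen hJ ht.1
  have dp0 := sp0.hasDerivAt_of_isOpen hJ ht.1
  obtain ⟨dv, dy⟩ := h.hasDerivAt_plus hJ ht.1
  rw [← deriv_eq_of_eqOn_isOpen h.plus_eqOn.1 hJ ht.1] at dv dy ⊢
  rw [← deriv_eq_of_eqOn_isOpen h.plus_eqOn.2 hJ ht.1]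
  rw [h.eq _ ht.1] at dv dy ⊢
  rw [h.eq _ ht.2]
  simp only [superpose] at dv dy ⊢
  refine ⟨HasDerivAt.prodMk ?_ ?_, hasDerivAt_pi.2 fun i => ?_⟩
  · refine HasDerivAt.congr_deriv (((dp0.const_mul (-(1 / 2) : ℝ)).mul_const (σm t.2).q0).mul
      (dp.sub_const (σm t.2).q)) ?_
    simp only [surfacePoint, psiInv, superpose]
    ring
  · exact (dv.add_const (σm t.2).v).congr_deriv rfl
  · have d := ((dp0.pow 2).const_mul (1 / 8 : ℝ)).mul_const ((σm t.2).q0 ^ 2)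
    have dq := dp.mul_const (σm t.2).q
    have dpq := dp.sub_const (σm t.2).q
    fin_cases i
    · refine HasDerivAt.congr_deriv (((dy 0).add_const ((σm t.2).y 0)).add
        ((d.mul dpq).mul (dq.const_add 1))) ?_
      simp [plusRate, plusX, superpose]
      ring
    · refine HasDerivAt.congr_deriv (((dy 1).add_const ((σm t.2).y 1)).sub
        ((d.mul dpq).mul (dq.const_sub 1))) ?_
      simp [plusRate, plusX, superpose]
      ring
    · refine HasDerivAt.congr_deriv (((dy 2).add_const ((σm t.2).y 2)).sub
        (d.mul ((dp.pow 2).sub_const ((σm t.2).q ^ 2)))) ?_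
      simp [plusRate, plusX, superpose]
      ring

theorem hasDerivAt_surfacePoint_minus (hJ : IsOpen J) (h : IsDecomposition J σ σp σm) {t : ℝ × ℝ}
    (ht : t ∈ J ×ˢ J) :
    HasDerivAt (fun a => ((surfacePoint σp σm (t.1, a)).u, (surfacePoint σp σm (t.1, a)).v))
      (minusUV (σ t.1).p (σ t.2).q (σ t.1).p0 (σ t.2).q0 (deriv (fun s => (σ s).q) t.2)
        (deriv (fun s => (σ s).q0) t.2)) t.2 ∧
    HasDerivAt (fun a => (surfacePoint σp σm (t.1, a)).x)
      (minusX (σ t.1).p (σ t.2).q (σ t.1).p0 (σ t.2).q0 (deriv (fun s => (σ s).q) t.2)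
        (deriv (fun s => (σ s).q0) t.2)) t.2 := by
  obtain ⟨sq, sq0, -, -⟩ := h.minus.contDiffOn
  have dq := sq.hasDerivAt_of_isOpen hJ ht.2
  have dq0 := sq0.hasDerivAt_of_isOpen hJ ht.2
  obtain ⟨dv, dy⟩ := h.hasDerivAt_minus hJ ht.2
  rw [← deriv_eq_of_eqOn_isOpen h.minus_eqOn.1 hJ ht.2] at dv dy ⊢
  rw [← deriv_eq_of_eqOn_isOpen h.minus_eqOn.2 hJ ht.2]
  rw [h.eq _ ht.2] at dv dy ⊢
  rw [h.eq _ ht.1]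
  simp only [superpose] at dv dy ⊢
  refine ⟨HasDerivAt.prodMk ?_ ?_, hasDerivAt_pi.2 fun i => ?_⟩
  · refine HasDerivAt.congr_deriv ((dq0.const_mul (-(1 / 2) * (σp t.1).p0)).mul
      (dq.const_sub (σp t.1).p)) ?_
    simp only [surfacePoint, psiInv, superpose]
    ring
  · refine (dv.const_add (σp t.1).v).congr_deriv ?_
    simp [plusRate]
  · have d := (dq0.pow 2).const_mul (1 / 8 * (σp t.1).p0 ^ 2)
    have dp := dq.const_mul (σp t.1).p
    have dpq := dq.const_sub (σp t.1).p
    fin_cases i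
    · refine HasDerivAt.congr_deriv (((dy 0).const_add ((σp t.1).y 0)).add
        ((d.mul dpq).mul (dp.const_add 1))) ?_
      simp [plusRate, minusX, superpose]
      ring
    · refine HasDerivAt.congr_deriv (((dy 1).const_add ((σp t.1).y 1)).sub
        ((d.mul dpq).mul (dp.const_sub 1))) ?_
      simp [plusRate, minusX, superpose]
      ring
    · refine HasDerivAt.congr_deriv (((dy 2).const_add ((σp t.1).y 2)).sub
        (d.mul ((dq.pow 2).const_sub ((σp t.1).p ^ 2)))) ?_
      simp [plusRate, minusX, superpose]
      ring

end Surface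

/-! ### The isometric embedding -/

theorem isIsometricEmbedding_congr {U : Set (ℝ × ℝ)} {ι κ : ℝ × ℝ → Mink}
    (h : IsIsometricEmbedding U ι) (hικ : Set.EqOn ι κ U) : IsIsometricEmbedding U κ where
  isOpen := h.isOpen
  nondegenerate := h.nondegenerate
  smooth := h.smooth.congr fun m hm => (hικ hm).symm
  isometric m hm w z := by
    have hev : ι =ᶠ[nhds m] κ := Filter.mem_of_superset (h.isOpen.mem_nhds hm) hικ
    rw [← hev.fderiv_eq]
    exact h.isometric m hm w z
  embedding := by
    have : U.domRestrict κ = U.domRestrict ι := funext fun m => (hικ m.2).symm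
    exact this ▸ h.embedding

theorem definesEmbedding_congr {γ : ℝ → Mink} {J : Set ℝ} {S T : ℝ → ℝ → YSpace}
    (h : DefinesEmbedding γ J S) (hST : ∀ t₁ ∈ J, ∀ t₂ ∈ J, S t₁ t₂ = T t₁ t₂) :
    DefinesEmbedding γ J T := by
  obtain ⟨e, hs, he, h1, h2, h3, h4⟩ := h
  have hEq : Set.EqOn (fun m => (psiInv (S (e.symm m).1 (e.symm m).2)).x)
      (fun m => (psiInv (T (e.symm m).1 (e.symm m).2)).x) e.target := by
    intro m hm
    have := e.map_target hm
    rw [hs] at this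
    simp only [hST _ this.1 _ this.2]
  refine ⟨e, hs, fun t₁ ht₁ t₂ ht₂ => ?_, h1, h2, isIsometricEmbedding_congr h3 hEq, ?_⟩
  · rw [← hST t₁ ht₁ t₂ ht₂]
    exact he t₁ ht₁ t₂ ht₂
  · rwa [← hEq.image_eq]

section Surface

variable {J : Set ℝ} {σ : ℝ → YSpace} {σp : ℝ → HatPlus} {σm : ℝ → HatMinus}

/-- The chart `e` gives the coordinates (u, v). The chart `f` serves only the topological claim: `f
∘ e.symm` is an embedding that factors through the surface map and the continuous projection to (x₁,
x₂), so the surface map is itself an embedding. -/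
theorem isIsometricEmbedding_surface (hJ : IsOpen J) (h : IsDecomposition J σ σp σm)
    {I : Set ℝ} (hIJ : I ⊆ J)
    (hu : ∀ t₁ ∈ I, ∀ t₂ ∈ I, (σ t₁).p ≠ (σ t₂).q ∧ (σ t₁).p0 ≠ 0 ∧ (σ t₂).q0 ≠ 0)
    {e f : OpenPartialHomeomorph (ℝ × ℝ) (ℝ × ℝ)} (hes : e.source = I ×ˢ I)
    (hfs : f.source = I ×ˢ I)
    (he : ⇑e = fun t => ((surfacePoint σp σm t).u, (surfacePoint σp σm t).v))
    (hf : ⇑f = fun t => ((surfacePoint σp σm t).x 0, (surfacePoint σp σm t).x 1))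
    (hsymm : ContDiffOn ℝ ∞ e.symm e.target) :
    IsIsometricEmbedding e.target (fun m => (surfacePoint σp σm (e.symm m)).x) := by
  have hmem : ∀ m ∈ e.target, e.symm m ∈ I ×ˢ I := fun m hm => hes ▸ e.map_target hm
  have hmem' : ∀ m ∈ e.target, e.symm m ∈ J ×ˢ J :=
    fun m hm => Set.prod_mono hIJ hIJ (hmem m hm)
  have hsm : ContDiffOn ℝ ∞ (fun m => (surfacePoint σp σm (e.symm m)).x) e.target :=
    (contDiffOn_surfacePoint_x h).comp hsymm hmem'
  have heq : ∀ m ∈ e.target,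
      m = ((surfacePoint σp σm (e.symm m)).u, (surfacePoint σp σm (e.symm m)).v) := by
    intro m hm
    have := e.right_inv hm
    rw [he] at this
    exact this.symm
  refine ⟨e.open_target, fun m hm => ?_, hsm, fun m hm w z => ?_, ?_⟩
  · obtain ⟨h1, h2, h3⟩ := hu _ (hmem m hm).1 _ (hmem m hm).2
    have hm1 := congrArg Prod.fst (heq m hm)
    rw [hm1, surfacePoint_u h (hmem' m hm)]
    exact mul_ne_zero (mul_ne_zero (mul_ne_zero (by norm_num) h2) h3) (sub_ne_zero.2 h1)
  · set t := e.symm m with ht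
    have htJ := hmem' m hm
    rw [← ht] at htJ
    have hOpen : J ×ˢ J ∈ nhds t := (hJ.prod hJ).mem_nhds htJ
    have dX := ((contDiffOn_surfacePoint_x h).contDiffAt hOpen).differentiableAt (by simp)
    have dU := ((contDiffOn_surfacePoint_uv h).contDiffAt hOpen).differentiableAt (by simp)
    have dS := (hsymm.contDiffAt (e.open_target.mem_nhds hm)).differentiableAt (by simp)
    obtain ⟨pu, px⟩ := hasDerivAt_surfacePoint_plus hJ h htJ
    obtain ⟨mu, mx⟩ := hasDerivAt_surfacePoint_minus hJ h htJ
    have hX : ∀ w, fderiv ℝ (fun m => (surfacePoint σp σm (e.symm m)).x) m w =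
        fderiv ℝ (fun t => (surfacePoint σp σm t).x) t (fderiv ℝ e.symm m w) := fun w =>
      congrArg (fun L => L w) (fderiv_comp m dX dS)
    -- Every tangent vector at m is written as the image under d(u, v) of a vector in the parameters
    -- (t₁, t₂), so that both metrics can be compared through the partial derivatives there.
    have hU : ∀ w, w = fderiv ℝ
        (fun t => ((surfacePoint σp σm t).u, (surfacePoint σp σm t).v)) t
          (fderiv ℝ e.symm m w) := by
      intro w
      have h1 : (fun t => ((surfacePoint σp σm t).u, (surfacePoint σp σm t).v)) ∘ e.symm
          =ᶠ[nhds m] id :=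
        Filter.mem_of_superset (e.open_target.mem_nhds hm) fun m hm => (heq m hm).symm
      have h2 := (fderiv_comp m dU dS).symm.trans (h1.fderiv_eq.trans fderiv_id)
      exact (congrArg (fun L => L w) h2).symm
    have hw := hU w
    have hz := hU z
    rw [hX, hX, fderiv_apply_of_partials dX px mx, fderiv_apply_of_partials dX px mx]
    rw [fderiv_apply_of_partials dU pu mu] at hw hz
    rw [mink_eq_gZero_of_partials _ _ _ _ _ _ _ _ m.2, ← hw, ← hz, ← surfacePoint_u h htJ,
      show (surfacePoint σp σm t).u = m.1 from (congrArg Prod.fst (heq m hm)).symm]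
  · have hsrc : (e.symm.trans f).source = e.target := by
      rw [OpenPartialHomeomorph.trans_source, e.symm_source, hfs]
      exact Set.inter_eq_left.2 hmem
    have hemb := (e.symm.trans f).isOpenEmbedding_restrict.isEmbedding
    rw [hsrc] at hemb
    refine Topology.IsEmbedding.of_comp (g := fun x : Mink => (x 0, x 1))
      hsm.continuousOn.domRestrict (by fun_prop) ?_
    convert hemb using 1
    ext m
    · simp [hf]
    · simp [hf]

/-- A decomposition defines an isometric embedding near each point of the initial curve where
`p₀ = q₀`, `p₀' = q₀'` do not vanish and `p + q` is not stationary. -/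
theorem exists_definesEmbedding {γ : ℝ → Mink} (hJ : IsOpen J) (h : IsDecomposition J σ σp σm)
    (hγ : ∀ t ∈ J, (psiInv (σ t)).x = γ t) {t₀ : ℝ} (ht₀ : t₀ ∈ J)
    (hp0 : (σ t₀).p0 ≠ 0) (hq0 : (σ t₀).q0 = (σ t₀).p0)
    (hdp0 : deriv (fun t => (σ t).p0) t₀ ≠ 0)
    (hdq0 : deriv (fun t => (σ t).q0) t₀ = deriv (fun t => (σ t).p0) t₀)
    (hpq : (σ t₀).p ≠ (σ t₀).q)
    (hdpq : deriv (fun t => (σ t).p) t₀ + deriv (fun t => (σ t).q) t₀ ≠ 0) :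
    ∃ V ∈ nhds (t₀, t₀), ∀ I ⊆ J, IsOpen I → I ×ˢ I ⊆ V →
      (∀ t₁ ∈ I, ∀ t₂ ∈ I, (σ t₁).p ≠ (σ t₂).q ∧ (σ t₁).p0 ≠ 0 ∧ (σ t₂).q0 ≠ 0) →
      DefinesEmbedding γ I (fun t₁ t₂ => superpose (σp t₁) (σm t₂)) := by
  have hmem : (t₀, t₀) ∈ J ×ˢ J := ⟨ht₀, ht₀⟩
  obtain ⟨pu, px⟩ := hasDerivAt_surfacePoint_plus hJ h hmem
  obtain ⟨mu, mx⟩ := hasDerivAt_surfacePoint_minus hJ h hmem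
  have px' := (hasDerivAt_pi.1 px 0).prodMk (hasDerivAt_pi.1 px 1)
  have mx' := (hasDerivAt_pi.1 mx 0).prodMk (hasDerivAt_pi.1 mx 1)
  have hpq' := sub_ne_zero.2 hpq
  -- The determinant at (t₀, t₀) is -(1/4) p₀³ p₀' (p - q)(p' + q').
  obtain ⟨V, hV, hV₀, -, hVe⟩ := exists_openPartialHomeomorph_of_jacobian (hJ.prod hJ)
    (contDiffOn_surfacePoint_uv h) hmem pu mu (by
      simp only [hq0, hdq0, plusUV, minusUV]
      intro h0
      refine mul_ne_zero (mul_ne_zero (mul_ne_zero (pow_ne_zero 3 hp0) hdp0) hpq') hdpq ?_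
      linear_combination -4 * h0)
  have hsx := XSpace.contDiffOn_coords_iff.1 (contDiffOn_coords_surfacePoint h)
  -- For (x₁, x₂) the determinant is (1/16) p₀⁷ p₀' (p - q)³ (p' + q').
  obtain ⟨W, hW, hW₀, -, hWf⟩ := exists_openPartialHomeomorph_of_jacobian (hJ.prod hJ)
    ((hsx.2.2.2.2.1 0).prodMk (hsx.2.2.2.2.1 1)) hmem px' mx' (by
      simp only [hq0, hdq0, plusX, minusX, Matrix.cons_val]
      intro h0
      refine mul_ne_zero (mul_ne_zero (mul_ne_zero (pow_ne_zero 7 hp0) hdp0)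
        (pow_ne_zero 3 hpq')) hdpq ?_
      linear_combination 16 * h0)
  refine ⟨V ∩ W, (hV.inter hW).mem_nhds ⟨hV₀, hW₀⟩, fun I hIJ hI hIV hu => ?_⟩
  obtain ⟨e, hes, he, hsymm⟩ := hVe (I ×ˢ I) (fun x hx => (hIV hx).1) (hI.prod hI)
  obtain ⟨f, hfs, hf, -⟩ := hWf (I ×ˢ I) (fun x hx => (hIV hx).2) (hI.prod hI)
  refine ⟨e, hes, fun t₁ _ t₂ _ => congrFun he (t₁, t₂), ?_, hsymm,
    isIsometricEmbedding_surface hJ h hIJ hu hes hfs he hf hsymm, ?_⟩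
  · rw [hes, he]
    exact (contDiffOn_surfacePoint_uv h).mono (Set.prod_mono hIJ hIJ)
  · rintro _ ⟨t, ht, rfl⟩
    have hts : (t, t) ∈ e.source := hes ▸ ⟨ht, ht⟩
    refine ⟨e (t, t), e.map_source hts, ?_⟩
    simp only [e.left_inv hts]
    rw [← h.eq t (hIJ ht), hγ t (hIJ ht)]

end Surface

/-! ### Quadratures -/

section Quadratures

variable {γ : ℝ → Mink} {J : Set ℝ} {f g : ℝ → ℝ}

theorem CauchyEmbedding.ByQuadratures.neg (hf : ByQuadratures γ J f) :
    ByQuadratures γ J (fun t => -f t) :=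
  ((ByQuadratures.const (-1)).mul hf).congr fun t _ => neg_one_mul (f t)

theorem CauchyEmbedding.ByQuadratures.sub (hf : ByQuadratures γ J f) (hg : ByQuadratures γ J g) :
    ByQuadratures γ J (fun t => f t - g t) :=
  (hf.add hg.neg).congr fun t _ => (sub_eq_add_neg (f t) (g t)).symm

theorem CauchyEmbedding.ByQuadratures.pow (hf : ByQuadratures γ J f) (n : ℕ) :
    ByQuadratures γ J (fun t => f t ^ n) := by
  induction n with
  | zero => simpa using ByQuadratures.const 1
  | succ n ih => simpa only [pow_succ] using ih.mul hf

theorem byQuadratures_plusRate {p p0 p' : ℝ → ℝ} (hp : ByQuadratures γ J p)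
    (hp0 : ByQuadratures γ J p0) (hp' : ByQuadratures γ J p') (i : Fin 4) :
    ByQuadratures γ J (fun t => plusRate (p t) (p0 t) (p' t) i) := by
  fin_cases i
  · exact (((ByQuadratures.const _).mul (hp0.pow 2)).mul hp').neg
  · exact ((((ByQuadratures.const _).mul (hp0.pow 4)).mul ((hp.pow 2).add (.const _))).mul hp').neg
  · exact ((((ByQuadratures.const _).mul (hp0.pow 4)).mul ((hp.pow 2).sub (.const _))).mul hp').neg
  · exact (((ByQuadratures.const _).mul hp).mul (hp0.pow 4)).mul hp'

/-- `f` is differentiable on `J`, and `f` and its derivative are obtained by quadratures. -/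
structure ByQuadraturesWithDeriv (γ : ℝ → Mink) (J : Set ℝ) (f : ℝ → ℝ) : Prop where
  self : ByQuadratures γ J f
  differentiableAt : ∀ t ∈ J, DifferentiableAt ℝ f t
  deriv : ByQuadratures γ J (deriv f)

namespace ByQuadraturesWithDeriv

theorem const (c : ℝ) : ByQuadraturesWithDeriv γ J (fun _ => c) :=
  ⟨.const c, fun _ _ => differentiableAt_const c, by simpa using ByQuadratures.const 0⟩

theorem param : ByQuadraturesWithDeriv γ J (fun t => t) :=
  ⟨.param, fun _ _ => differentiableAt_id, by simpa using ByQuadratures.const 1⟩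

theorem add (hf : ByQuadraturesWithDeriv γ J f) (hg : ByQuadraturesWithDeriv γ J g) :
    ByQuadraturesWithDeriv γ J (fun t => f t + g t) :=
  ⟨hf.self.add hg.self, fun t ht => (hf.differentiableAt t ht).add (hg.differentiableAt t ht),
    (hf.deriv.add hg.deriv).congr fun t ht =>
      ((hf.differentiableAt t ht).hasDerivAt.add (hg.differentiableAt t ht).hasDerivAt).deriv.symm⟩

theorem mul (hf : ByQuadraturesWithDeriv γ J f) (hg : ByQuadraturesWithDeriv γ J g) :
    ByQuadraturesWithDeriv γ J (fun t => f t * g t) :=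
  ⟨hf.self.mul hg.self, fun t ht => (hf.differentiableAt t ht).mul (hg.differentiableAt t ht),
    ((hf.deriv.mul hg.self).add (hf.self.mul hg.deriv)).congr fun t ht =>
      ((hf.differentiableAt t ht).hasDerivAt.mul (hg.differentiableAt t ht).hasDerivAt).deriv.symm⟩

theorem neg (hf : ByQuadraturesWithDeriv γ J f) : ByQuadraturesWithDeriv γ J (fun t => -f t) := by
  simpa using (const (-1)).mul hf

theorem sub (hf : ByQuadraturesWithDeriv γ J f) (hg : ByQuadraturesWithDeriv γ J g) :
    ByQuadraturesWithDeriv γ J (fun t => f t - g t) := by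
  simpa [sub_eq_add_neg] using hf.add hg.neg

theorem inv (hf : ByQuadraturesWithDeriv γ J f) (h : ∀ t ∈ J, f t ≠ 0) :
    ByQuadraturesWithDeriv γ J (fun t => (f t)⁻¹) :=
  ⟨hf.self.inv h, fun t ht => (hf.differentiableAt t ht).inv (h t ht),
    (hf.deriv.neg.mul ((hf.self.pow 2).inv fun t ht => pow_ne_zero 2 (h t ht))).congr fun t ht =>
      ((hf.differentiableAt t ht).hasDerivAt.inv (h t ht)).deriv.symm⟩

theorem div (hf : ByQuadraturesWithDeriv γ J f) (hg : ByQuadraturesWithDeriv γ J g)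
    (h : ∀ t ∈ J, g t ≠ 0) : ByQuadraturesWithDeriv γ J (fun t => f t / g t) := by
  simpa [div_eq_mul_inv] using hf.mul (hg.inv h)

theorem congr (hJ : IsOpen J) (hf : ByQuadraturesWithDeriv γ J f) (h : Set.EqOn f g J) :
    ByQuadraturesWithDeriv γ J g :=
  ⟨hf.self.congr h,
    fun t ht => (hf.differentiableAt t ht).congr_of_eventuallyEq
      (Filter.mem_of_superset (hJ.mem_nhds ht) h.symm),
    hf.deriv.congr fun _ ht => deriv_eq_of_eqOn_isOpen h hJ ht⟩

/-- This is where the generators x̄ᵢ'' enter: the rates of v and y contain p' and q', and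
quadratures alone are not closed under differentiation. -/
theorem vel (hJ : IsOpen J) (hγ : ContDiffOn ℝ ∞ γ J) (i : Fin 3) :
    ByQuadraturesWithDeriv γ J (vel γ i) :=
  ⟨.coord_deriv i,
    fun _ ht => ((contDiffOn_vel hJ hγ i).hasDerivAt_of_isOpen hJ ht).differentiableAt,
    .coord_deriv_deriv i⟩

end ByQuadraturesWithDeriv

/-- If `p`, `q` and their derivatives, as well as `p₀` and `q₀`, are obtained by quadratures along
an integral curve of `V¹` over `γ`, then so are the curve and its decompositions. -/
theorem solvedByQuadratures_of_coords (hJ : IsOpen J) {N : Set XSpace} {σ : ℝ → XSpace}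
    (hσ : IsIntegralCurveOne J N σ) (hx : ∀ t ∈ J, (σ t).x = γ t)
    (hp : ByQuadraturesWithDeriv γ J (fun t => (σ t).p))
    (hq : ByQuadraturesWithDeriv γ J (fun t => (σ t).q))
    (hp0 : ByQuadratures γ J (fun t => (σ t).p0)) (hq0 : ByQuadratures γ J (fun t => (σ t).q0)) :
    SolvedByQuadratures γ J σ := by
  have hplus := byQuadratures_plusRate hp.self hp0 hp.deriv
  have hminus := byQuadratures_plusRate hq.self hq0 hq.deriv
  have hX : ∀ i, ByQuadratures γ J (fun t => (σ t).x i) := fun i =>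
    (ByQuadratures.coord i).congr fun t ht => (congrFun (hx t ht) i).symm
  have hv : ByQuadratures γ J (fun t => (σ t).v) := by
    refine .integral ((hplus 0).sub (hminus 0)) fun t ht => ?_
    obtain ⟨-, -, -, -, -, sv⟩ := XSpace.contDiffOn_coords_iff.1 hσ.smooth
    refine (sv.hasDerivAt_of_isOpen hJ ht).congr_deriv ?_
    have := congrFun (hσ.integral t ht) 0
    simp only [VOne, XSpace.velocity, Matrix.cons_val, Pi.zero_apply] at this
    simp only [plusRate, Matrix.cons_val]
    linear_combination this
  refine ⟨fun i => ?_, fun σp σm h => ⟨?_, ?_, ?_, fun i => ?_⟩,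
    fun σp σm h => ⟨?_, ?_, ?_, fun i => ?_⟩⟩
  · fin_cases i
    exacts [hp.self, hq.self, hp0, hq0, hX 0, hX 1, hX 2, hv]
  · exact hp.self.congr h.plus_eqOn.1.symm
  · exact hp0.congr h.plus_eqOn.2.symm
  · exact .integral (hplus 0) fun t ht => (h.hasDerivAt_plus hJ ht).1
  · exact .integral (hplus i.succ) fun t ht => (h.hasDerivAt_plus hJ ht).2 i
  · exact hq.self.congr h.minus_eqOn.1.symm
  · exact hq0.congr h.minus_eqOn.2.symm
  · exact .integral (hminus 0).neg fun t ht => (h.hasDerivAt_minus hJ ht).1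
  · exact .integral (hminus i.succ).neg fun t ht => (h.hasDerivAt_minus hJ ht).2 i

/-- Since r' = ε is constant, s is rational in t and the x̄ᵢ', so no second antiderivative for r is
needed and p', q' are rational in t, x̄ᵢ', x̄ᵢ''. -/
theorem solvedByQuadratures_of_linear_radius (hJ : IsOpen J) (hγ : ContDiffOn ℝ ∞ γ J)
    (hD : ∀ t ∈ J, velDiff γ t ≠ 0) {N : Set XSpace} {σ : ℝ → XSpace} {ε : ℝ}
    (h : IsLift γ J N σ (fun t => ε * t)) : SolvedByQuadratures γ J σ := by
  have hr : ByQuadraturesWithDeriv γ J (fun t => ε * t) := .mul (.const ε) .param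
  have hr' : ByQuadraturesWithDeriv γ J (deriv fun t => ε * t) := by
    have : (deriv fun t : ℝ => ε * t) = fun _ => ε := by
      ext t
      simp
    exact this ▸ .const ε
  have hV := ByQuadraturesWithDeriv.vel hJ hγ
  have hm := (hV 2).div ((hV 1).sub (hV 0)) fun t ht h0 => hD t ht (by rw [velDiff]; linarith)
  have hs := ((hV 0).sub (hV 1)).div
    (((ByQuadraturesWithDeriv.const 2).mul ((hr.mul hr).mul hr)).mul hr') fun t ht =>
      mul_ne_zero (mul_ne_zero two_ne_zero (mul_ne_zero
        (mul_ne_zero (h.built.ne_zero t ht).1 (h.built.ne_zero t ht).1)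
        (h.built.ne_zero t ht).1)) (h.built.ne_zero t ht).2
  refine solvedByQuadratures_of_coords hJ h.integralCurve h.lifts
    ((hm.add hs).congr hJ fun t ht => ?_) ((hm.sub hs).congr hJ fun t ht => ?_)
    (hr.self.congr fun t ht => (h.built.p0_eq t ht).symm)
    (hr.self.congr fun t ht => (h.built.q0_eq t ht).symm)
  · rw [h.built.p_eq t ht, velDiff]
    ring
  · rw [h.built.q_eq t ht, velDiff]
    ring

end Quadratures

/-! ### Solution of the Cauchy problem -/

theorem CauchyEmbedding.IsDecomposition.mono {I J : Set ℝ} {σ : ℝ → YSpace} {σp : ℝ → HatPlus}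
    {σm : ℝ → HatMinus} (h : IsDecomposition J σ σp σm) (hIJ : I ⊆ J) :
    IsDecomposition I σ σp σm :=
  ⟨⟨h.plus.smooth.mono hIJ, fun t ht => h.plus.v_eq t (hIJ ht),
    fun t ht => h.plus.y0_eq t (hIJ ht), fun t ht => h.plus.y1_eq t (hIJ ht),
    fun t ht => h.plus.y2_eq t (hIJ ht)⟩,
   ⟨h.minus.smooth.mono hIJ, fun t ht => h.minus.v_eq t (hIJ ht),
    fun t ht => h.minus.y0_eq t (hIJ ht), fun t ht => h.minus.y1_eq t (hIJ ht),
    fun t ht => h.minus.y2_eq t (hIJ ht)⟩, fun t ht => h.eq t (hIJ ht)⟩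

theorem exists_Ioo_prod_subset {V : Set (ℝ × ℝ)} {t₀ : ℝ} (hV : V ∈ nhds (t₀, t₀)) :
    ∃ δ > 0, Set.Ioo (t₀ - δ) (t₀ + δ) ×ˢ Set.Ioo (t₀ - δ) (t₀ + δ) ⊆ V := by
  obtain ⟨δ, hδ, h⟩ := Metric.mem_nhds_iff.1 hV
  refine ⟨δ, hδ, ?_⟩
  rwa [← ball_prod_same, Real.ball_eq_Ioo] at h

/-- A solution of the second-order equation for `r` on an interval solves the Cauchy problem on a
smaller interval. -/
theorem exists_solvesCauchyProblem {a b t₀ : ℝ} {γ : ℝ → Mink} {r : ℝ → ℝ} {N : Set XSpace}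
    (ht₀ : t₀ ∈ Set.Ioo a b) (hγ : ContDiffOn ℝ ∞ γ (Set.Ioo a b))
    (hD : ∀ t ∈ Set.Ioo a b, velDiff γ t ≠ 0) (hr : ContDiffOn ℝ ∞ r (Set.Ioo a b))
    (hr₀ : ∀ t ∈ Set.Ioo a b, r t ≠ 0 ∧ deriv r t ≠ 0) (hode : RadiusODE γ (Set.Ioo a b) r)
    (hN : N = NFull ∨ (N = NOne ∧ 0 < r t₀ ∧ velDiff γ t₀ * r t₀ * deriv r t₀ < 0)) :
    ∃ (α β : ℝ) (σ : ℝ → XSpace), t₀ ∈ Set.Ioo α β ∧ Set.Ioo α β ⊆ Set.Ioo a b ∧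
      SolvesCauchyProblem γ t₀ (Set.Ioo α β) N σ r := by
  have hJ : IsOpen (Set.Ioo a b) := isOpen_Ioo
  have hm := contDiffOn_meanPQ hJ hγ hD
  have hs := contDiffOn_halfGap hJ hγ hr hr₀
  obtain ⟨v, hv⟩ := exists_antiderivative
    (f := fun t => -(r t ^ 2 * deriv (halfGap γ r) t)) (α := a) (β := b)
    ((hr.pow 2).mul (hs.deriv_infty hJ)).neg.continuousOn
  have hs₀ : ∀ t ∈ Set.Ioo a b, halfGap γ r t ≠ 0 := fun t ht => div_ne_zero (hD t ht)
    (mul_ne_zero (mul_ne_zero two_ne_zero (pow_ne_zero 3 (hr₀ t ht).1)) (hr₀ t ht).2)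
  set σ := radiusLift γ r v with hσ
  have hpq : ∀ t ∈ Set.Ioo a b, (σ t).p ≠ (σ t).q := fun t ht h => hs₀ t ht (by
    simp only [hσ, radiusLift] at h
    linarith)
  -- The curve is decomposed over the whole interval in `NFull` first: the final interval depends on
  -- the surface, and membership in `N` is only secured after shrinking.
  have hint : IsIntegralCurveOne (Set.Ioo a b) NFull σ :=
    isIntegralCurveOne_radiusLift hJ hγ hD hr hr₀ hode hv fun t ht =>
      ⟨hpq t ht, (hr₀ t ht).1, (hr₀ t ht).1⟩
  obtain ⟨σp, σm, hdec⟩ := exists_isDecomposition hint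
  have hNF : N ⊆ NFull := by
    rcases hN with rfl | ⟨rfl, -⟩
    exacts [subset_rfl, NOne_subset_NFull]
  have hnhds : Set.Ioo a b ∈ nhds t₀ := hJ.mem_nhds ht₀
  -- Points of the surface combine p, p₀ at t₁ with q, q₀ at t₂, so membership in `N` is needed on a
  -- neighbourhood of (t₀, t₀) in the plane, not only along the curve.
  have hcross : ∀ᶠ t : ℝ × ℝ in nhds (t₀, t₀), ∀ x w,
      (⟨(σ t.1).p, (σ t.2).q, (σ t.1).p0, (σ t.2).q0, x, w⟩ : XSpace) ∈ N := by
    have cr : ContinuousAt r t₀ := hr.continuousOn.continuousAt hnhds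
    have cp : ContinuousAt (fun t => (σ t).p) t₀ := (hm.add hs).continuousOn.continuousAt hnhds
    have cq : ContinuousAt (fun t => (σ t).q) t₀ := (hm.sub hs).continuousOn.continuousAt hnhds
    have cr₁ : ContinuousAt (fun t : ℝ × ℝ => r t.1) (t₀, t₀) :=
      cr.comp (f := Prod.fst) continuousAt_fst
    have cr₂ : ContinuousAt (fun t : ℝ × ℝ => r t.2) (t₀, t₀) :=
      cr.comp (f := Prod.snd) continuousAt_snd
    have cd : ContinuousAt (fun t : ℝ × ℝ => (σ t.1).p - (σ t.2).q) (t₀, t₀) :=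
      ContinuousAt.sub (cp.comp (x := (t₀, t₀)) (f := Prod.fst) continuousAt_fst)
        (cq.comp (x := (t₀, t₀)) (f := Prod.snd) continuousAt_snd)
    -- The last two conditions are the positivity of p₀ + q₀ and of u that cut out `NOne`. They are
    -- stated as implications so that the case `NFull`, where the signs are unrestricted, is covered
    -- as well.
    filter_upwards [cr₁.eventually_ne (hr₀ t₀ ht₀).1, cr₂.eventually_ne (hr₀ t₀ ht₀).1,
      cd.eventually_ne (sub_ne_zero.2 (hpq t₀ ht₀)),
      (cr₁.add cr₂).eventually (p := fun y => 0 < r t₀ → 0 < y) (by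
        by_cases h : 0 < r t₀
        · filter_upwards [lt_mem_nhds (add_pos h h)] with y hy _ using hy
        · exact Filter.Eventually.of_forall fun _ h' => absurd h' h),
      (((cr₁.const_mul (-(1 / 2))).mul cr₂).mul cd).eventually
        (p := fun y => velDiff γ t₀ * r t₀ * deriv r t₀ < 0 → 0 < y) (by
        by_cases h : velDiff γ t₀ * r t₀ * deriv r t₀ < 0
        · have : 0 < -(1 / 2) * r t₀ * r t₀ * ((σ t₀).p - (σ t₀).q) := by
            have h1 := (hr₀ t₀ ht₀).1
            have h2 := (hr₀ t₀ ht₀).2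
            have e : -(1 / 2) * r t₀ * r t₀ * ((σ t₀).p - (σ t₀).q) =
                -(velDiff γ t₀ * r t₀ * deriv r t₀) / (2 * r t₀ ^ 2 * deriv r t₀ ^ 2) := by
              simp only [hσ, radiusLift, halfGap]
              field_simp
              ring
            rw [e]
            exact div_pos (neg_pos.2 h) (by positivity)
          filter_upwards [lt_mem_nhds this] with y hy _ using hy
        · exact Filter.Eventually.of_forall fun _ h' => absurd h' h)] with t h1 h2 h3 h4 h5 x w
    rcases hN with rfl | ⟨rfl, hr₁, hD₁⟩
    · exact ⟨sub_ne_zero.1 h3, h1, h2⟩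
    · exact (mem_NOne_iff _).2 ⟨h5 hD₁, h4 hr₁, h1, h2⟩
  have hemb : ∃ V ∈ nhds (t₀, t₀), IsIndependentAt γ t₀ → ∀ I ⊆ Set.Ioo a b, IsOpen I →
      I ×ˢ I ⊆ V → (∀ t₁ ∈ I, ∀ t₂ ∈ I, (psi (σ t₁)).p ≠ (psi (σ t₂)).q ∧ (psi (σ t₁)).p0 ≠ 0 ∧
        (psi (σ t₂)).q0 ≠ 0) →
      DefinesEmbedding γ I (fun t₁ t₂ => superpose (σp t₁) (σm t₂)) := by
    -- The interval has to be fixed before independence is assumed; without independence there is no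
    -- restriction and the whole plane serves as neighbourhood.
    by_cases hind : IsIndependentAt γ t₀
    · obtain ⟨V, hV, h⟩ := exists_definesEmbedding hJ hdec
        (fun t _ => congrArg XSpace.x (psiInv_psi (σ t))) ht₀ (hr₀ t₀ ht₀).1 rfl (hr₀ t₀ ht₀).2 rfl
        (hpq t₀ ht₀) (by
          have dm := hm.hasDerivAt_of_isOpen hJ ht₀
          have ds := hs.hasDerivAt_of_isOpen hJ ht₀
          have ep : deriv (fun t => (psi (σ t)).p) t₀ = _ := (dm.add ds).deriv
          have eq : deriv (fun t => (psi (σ t)).q) t₀ = _ := (dm.sub ds).deriv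
          -- The terms ±s' cancel, so p' + q' is twice the derivative of `meanPQ`, which is
          -- -x̄₃'/(x̄₁' - x̄₂').
          rw [ep, eq]
          intro h0
          apply hind
          have : (fun t => vel γ 2 t / velDiff γ t) = fun t => -meanPQ γ t := by
            ext t
            rw [meanPQ, velDiff, ← neg_sub (vel γ 0 t), div_neg, neg_neg]
          rw [this]
          exact dm.neg.deriv.trans (by linarith))
      exact ⟨V, hV, fun _ => h⟩
    · exact ⟨Set.univ, Filter.univ_mem, fun h => absurd h hind⟩
  obtain ⟨V, hV, hVe⟩ := hemb
  obtain ⟨δ, hδ, hsub⟩ := exists_Ioo_prod_subset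
    (Filter.inter_mem (Filter.inter_mem hV hcross) (prod_mem_nhds hnhds hnhds))
  have hI : Set.Ioo (t₀ - δ) (t₀ + δ) ⊆ Set.Ioo a b := fun t ht => (hsub (Set.mk_mem_prod ht ht)).2.1
  have hNc : ∀ t₁ ∈ Set.Ioo (t₀ - δ) (t₀ + δ), ∀ t₂ ∈ Set.Ioo (t₀ - δ) (t₀ + δ), ∀ x w,
      (⟨(σ t₁).p, (σ t₂).q, (σ t₁).p0, (σ t₂).q0, x, w⟩ : XSpace) ∈ N :=
    fun t₁ h₁ t₂ h₂ => (hsub (Set.mk_mem_prod h₁ h₂)).1.2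
  have hlift : IsLift γ (Set.Ioo (t₀ - δ) (t₀ + δ)) N σ r :=
    isLift_radiusLift isOpen_Ioo (hγ.mono hI) (fun t ht => hD t (hI ht)) (hr.mono hI)
      (fun t ht => hr₀ t (hI ht)) (fun t ht => hode t (hI ht)) (fun t ht => hv t (hI ht))
      (fun t ht => hNc t ht t ht _ _) hNF
  refine ⟨t₀ - δ, t₀ + δ, σ, by simp [hδ], hI, hlift,
    hasUniqueDecomposition_psi hlift.integralCurve hNc (fun t ht => (hr₀ t (hI ht)).2)
      (fun t ht => (hr₀ t (hI ht)).2), fun hind τp τm hτ => ?_⟩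
  -- The neighbourhood was chosen for one fixed decomposition; any other one over the smaller
  -- interval gives the same surface.
  refine definesEmbedding_congr (hVe hind _ hI isOpen_Ioo (fun t ht => (hsub ht).1.1)
    fun t₁ h₁ t₂ h₂ => ?_) fun t₁ h₁ t₂ h₂ => (hdec.mono hI).superpose_eq hτ h₁ h₂
  exact hNF (hNc t₁ h₁ t₂ h₂ 0 0)

/-- Local solvability of the second-order equation for `r`. -/
theorem exists_radiusODE_solution {a b t₀ : ℝ} {γ : ℝ → Mink} (ht₀ : t₀ ∈ Set.Ioo a b)
    (hγ : ContDiffOn ℝ ∞ γ (Set.Ioo a b)) (hD : ∀ t ∈ Set.Ioo a b, velDiff γ t ≠ 0) {r₀ r₁ : ℝ}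
    (hr₀ : r₀ ≠ 0) (hr₁ : r₁ ≠ 0) :
    ∃ (r : ℝ → ℝ) (α β : ℝ), t₀ ∈ Set.Ioo α β ∧ Set.Ioo α β ⊆ Set.Ioo a b ∧
      r t₀ = r₀ ∧ deriv r t₀ = r₁ ∧ ContDiffOn ℝ ∞ r (Set.Ioo α β) ∧
      (∀ t ∈ Set.Ioo α β, r t ≠ 0 ∧ deriv r t ≠ 0) ∧ RadiusODE γ (Set.Ioo α β) r := by
  have hJ : IsOpen (Set.Ioo a b) := isOpen_Ioo
  -- Solving for r'' requires division by D⁴r. A solution that stays in `O` keeps r and r' free of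
  -- zeros.
  set O : Set (ℝ × ℝ × ℝ) := Set.Ioo a b ×ˢ ({0}ᶜ ×ˢ {0}ᶜ)
  have hO : IsOpen O := hJ.prod (isOpen_compl_singleton.prod isOpen_compl_singleton)
  have hfst : Set.MapsTo Prod.fst O (Set.Ioo a b) := fun x hx => hx.1
  have hd := contDiffOn_velDiff hJ hγ
  have c₁ : ContDiffOn ℝ ∞ (fun x : ℝ × ℝ × ℝ => velDiff γ x.1) O := hd.comp contDiffOn_fst hfst
  have c₂ : ContDiffOn ℝ ∞ (fun x : ℝ × ℝ × ℝ => deriv (velDiff γ) x.1) O :=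
    (hd.deriv_infty hJ).comp contDiffOn_fst hfst
  have c₃ : ContDiffOn ℝ ∞ (fun x : ℝ × ℝ × ℝ => velSq γ x.1) O :=
    (contDiffOn_velSq hJ hγ).comp contDiffOn_fst hfst
  have hG : ContDiffOn ℝ ∞ (fun x : ℝ × ℝ × ℝ =>
      (4 * velSq γ x.1 * x.2.1 ^ 6 * x.2.2 ^ 4 - 2 * velDiff γ x.1 ^ 4 * x.2.2 ^ 2
        + velDiff γ x.1 ^ 3 * deriv (velDiff γ) x.1 * x.2.1 * x.2.2)
        / (velDiff γ x.1 ^ 4 * x.2.1)) O := by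
    refine ContDiffOn.div (by fun_prop) (by fun_prop) fun x hx => ?_
    exact mul_ne_zero (pow_ne_zero 4 (hD x.1 hx.1)) hx.2.1
  obtain ⟨r, ε, hε, h0, h1, hsm, h⟩ := exists_smooth_solution_secondOrder (t₀ := t₀) (r₀ := r₀)
    (r₁ := r₁) hO hG ⟨ht₀, hr₀, hr₁⟩
  refine ⟨r, t₀ - ε, t₀ + ε, by simp [hε], fun t ht => (h t ht).1.1, h0, h1, hsm,
    fun t ht => (h t ht).1.2, fun t ht => ?_⟩
  have hDt := hD t (h t ht).1.1
  have hrt : r t ≠ 0 := (h t ht).1.2.1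
  rw [(h t ht).2]
  field_simp
  ring

/-- With r'' = 0 and only even total powers of ε remaining, the second-order equation for εt is the
constraint relation itself. -/
theorem radiusODE_linear {γ : ℝ → Mink} {J : Set ℝ} (h : ConstraintRelation γ J) {ε : ℝ}
    (hε : ε = 1 ∨ ε = -1) : RadiusODE γ J (fun t => ε * t) := by
  intro t ht
  have hd : (deriv fun t : ℝ => ε * t) = fun _ => ε := by
    ext t
    simp
  have := h t ht
  simp only [hd, deriv_const]
  rcases hε with rfl | rfl <;> linear_combination this

theorem mainTheorem6 (a b t₀ : ℝ) (γ : ℝ → Mink) (ht₀ : t₀ ∈ Set.Ioo a b)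
    (hγ : ContDiffOn ℝ ∞ γ (Set.Ioo a b))
    (himm : ∀ t ∈ Set.Ioo a b, deriv γ t ≠ 0)
    (h12 : ∀ t ∈ Set.Ioo a b, vel γ 0 t - vel γ 1 t ≠ 0)
    (h3 : ∀ t ∈ Set.Ioo a b, vel γ 2 t ≠ 0) :
    (∃ (α β : ℝ) (σ : ℝ → XSpace) (r : ℝ → ℝ),
      t₀ ∈ Set.Ioo α β ∧ Set.Ioo α β ⊆ Set.Ioo a b ∧
      SolvesCauchyProblem γ t₀ (Set.Ioo α β) NOne σ r) ∧
    (ConstraintRelation γ (Set.Ioo a b) →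
      ∀ ε : ℝ, (ε = 1 ∨ ε = -1) →
      ∀ N : Set XSpace, (N = NFull ∨ (N = NOne ∧ velDiff γ t₀ * t₀ < 0 ∧ 0 < ε * t₀)) →
      ∃ (α β : ℝ) (σ : ℝ → XSpace),
        t₀ ∈ Set.Ioo α β ∧ Set.Ioo α β ⊆ Set.Ioo a b ∧
        SolvesCauchyProblem γ t₀ (Set.Ioo α β) N σ (fun t => ε * t) ∧
        SolvedByQuadratures γ (Set.Ioo α β) σ) := by
  refine ⟨?_, fun hrel ε hε N hN => ?_⟩
  -- The initial values r = 1, r' = -D give Drr' = -D² < 0 at t₀, hence u > 0 there, and r > 0 gives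
  -- p₀ + q₀ > 0.
  · obtain ⟨r, α, β, hαβ, hsub, h0, h1, hr, hr₀, hode⟩ := exists_radiusODE_solution ht₀ hγ h12
      one_ne_zero (neg_ne_zero.2 (h12 t₀ ht₀))
    obtain ⟨α', β', σ, h₁, h₂, h₃⟩ := exists_solvesCauchyProblem (N := NOne) hαβ (hγ.mono hsub)
      (fun t ht => h12 t (hsub ht)) hr hr₀ hode (Or.inr ⟨rfl, by simp [h0], by
        rw [h0, h1, mul_one, mul_neg]
        exact neg_neg_of_pos (mul_self_pos.2 (h12 t₀ ht₀))⟩)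
    exact ⟨α', β', σ, r, h₁, h₂.trans hsub, h₃⟩
  · have hd : (deriv fun t : ℝ => ε * t) = fun _ => ε := by
      ext t
      simp
    have hε₀ : ε ≠ 0 := by rcases hε with rfl | rfl <;> norm_num
    -- At t = 0 the constraint relation would reduce to 2D⁴ = 0.
    have ht : ∀ t ∈ Set.Ioo a b, t ≠ 0 := by
      rintro t ht rfl
      have := hrel 0 ht
      norm_num at this
      exact h12 0 ht this
    obtain ⟨α, β, σ, h₁, h₂, h₃⟩ := exists_solvesCauchyProblem (N := N) (r := fun t => ε * t) ht₀ hγ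
      h12 (contDiffOn_const.mul contDiffOn_id)
      (fun t h => ⟨mul_ne_zero hε₀ (ht t h), by rw [hd]; exact hε₀⟩) (radiusODE_linear hrel hε)
      -- As ε² = 1, the sign condition on Drr' is the one on Dt.
      (hN.imp_right fun h => ⟨h.1, h.2.2, by
        rw [hd]
        rcases hε with rfl | rfl <;> linarith [h.2.1]⟩)
    exact ⟨α, β, σ, h₁, h₂, h₃, solvedByQuadratures_of_linear_radius isOpen_Ioo (hγ.mono h₂)
      (fun t h => h12 t (h₂ h)) h₃.lift⟩
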